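/- **Setting.** Let $n\ge 1$ be an integer. Let $\mathfrak S$ be an oriented punctured surface without boundary (not necessarily connected) with an ideal triangulation $\lambda$ without self-folded triangles. Thus $\mathfrak S$ is obtained from a finite set $\mathbb F_\lambda$ of oriented ideal triangles by gluing all their edges in pairs by orientation-reversing identifications, where the two sides of every edge belong to different triangles. The punctures are the classes of ideal vertices of the triangles under the gluing; let $\mathcal P$ be the set of punctures. Label the ideal vertices of each triangle $\tau$ by $v_1,v_2,v_3$ in clockwise order and let $V_\tau$ be the set of points of $\tau$ with barycentric coordinates $(x_1,x_2,x_3)\in\mathbb Z_{\ge 0}^3$, $x_1+x_2+x_3=n$, other than $v_1=(n,0,0)$, $v_2=(0,n,0)$, $v_3=(0,0,n)$. Subdivide $\tau$ into $n^2$ small triangles by the lines on which one coordinate is a constant integer. Orient each small edge in $\partial\tau$ not adjacent to an ideal vertex counterclockwise, with weight $\tfrac12$, and each small edge in the interior of $\tau$ like the boundary edge of $\tau$ parallel to it, with weight $1$. Let $V_\lambda=\big(\bigsqcup_\tau V_\tau\big)/\!\sim$ be the set of small vertices after gluing (edges being glued compatibly with barycentric coordinates), and let $Q_\lambda\colon V_\lambda\times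 V_\lambda\to\tfrac12\mathbb Z$ be the matrix for which $Q_\lambda(v,v')$ is the total weight of the arrows from $v$ to $v'$ minus that of the arrows from $v'$ to $v$, over all triangles. Let ${\bf k}_j\in\mathbb Z^{V_\tau}$, ${\bf k}_j(x)=x_j$, and let $\mathcal B_\tau\subset\mathbb Z^{V_\tau}$ be the subgroup generated by ${\bf k}_1,{\bf k}_2,{\bf k}_3$ and $(n\mathbb Z)^{V_\tau}$. Let $\mathcal B_\lambda\subset\mathbb Z^{V_\lambda}$ be the group of vectors whose pullback to $V_\tau$ lies in $\mathcal B_\tau$ for every $\tau\in\mathbb F_\lambda$. For $1\le i\le n-1$ let ${\bf a}(\tau,v_j,i)\in\mathbb Z^{V_\tau}$ be the indicator function of $\{x : x_j=n-i\}$ and put $$ {\bf b}(\tau,v_j,i)=\sum_{1\le t\le n-i-1} n(t+i-n)\,{\bf a}(\tau,v_j,t)+(n-i)\,{\bf k}_j .$$ For a puncture $p$ let ${\bf b}(\lambda,p,i)\in\mathbb Z^{V_\lambda}$ be the vector whose pullback to each $V_\tau$ is the sum of the ${\bf b}(\tau,v_j,i)$ over those $j$ for which the ideal vertex $v_j$ of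 $\tau$ is located at $p$. Let $\hat\omega^{1/2}\in\mathbb C^*$, let $\hat\omega=(\hat\omega^{1/2})^2$ and $\omega=\hat\omega^{n^2}$. Let $\mathcal Z_{\hat\omega}(\mathfrak S,\lambda)$ be the $\mathbb C$-algebra generated by $Z_v^{\pm1}$, $v\in V_\lambda$, with relations $Z_vZ_{v'}=\hat\omega^{2Q_\lambda(v,v')}Z_{v'}Z_v$. For ${\bf t}\in\mathbb Z^{V_\lambda}$ let $Z^{\bf t}=\hat\omega^{-\sum_{i<j}t_{v_i}t_{v_j}Q_\lambda(v_i,v_j)}Z_{v_1}^{t_{v_1}}\cdots Z_{v_r}^{t_{v_r}}$ be the Weyl-ordered monomial, where $v_1,\dots,v_r$ is any enumeration of $V_\lambda$. Let $\mathcal Z^{\rm bl}_{\hat\omega}(\mathfrak S,\lambda)=\operatorname{span}_{\mathbb C}\{Z^{\bf k}\mid {\bf k}\in\mathcal B_\lambda\}$ be the balanced Fock–Goncharov algebra. **Statement.** 1. The vectors ${\bf b}(\lambda,p,i)$, for $1\le i\le n-1$ and $p\in\mathcal P$, are $\mathbb Z$-linearly independent, and they generate the group $\{{\bf k}\in\mathcal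 B_\lambda\mid {\bf k}Q_\lambda{\bf t}^T=0\text{ for all }{\bf t}\in\mathcal B_\lambda\}$. This group is equal to $\{{\bf k}\in\mathcal B_\lambda\mid{\bf k}Q_\lambda={\bf 0}\}$. 2. If $\omega$ is not a root of unity, then the center of $\mathcal Z^{\rm bl}_{\hat\omega}(\mathfrak S,\lambda)$ is the Laurent polynomial algebra over $\mathbb C$ in the elements $Z^{{\bf b}(\lambda,p,i)}$, for $1\le i\le n-1$ and $p\in\mathcal P$. That is, these elements are invertible and central, and the homomorphism from the Laurent polynomial algebra in variables $x_{p,i}$ to the center with $x_{p,i}\mapsto Z^{{\bf b}(\lambda,p,i)}$ is an isomorphism. -/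

import Mathlib

namespace FockGoncharov

/-! ### Quantum tori -/

section QuantumTorus

variable {V : Type*}

/-- Defining relations of the quantum torus. The free generators are `Sum.inl v` (the variable `Z_v`)
and `Sum.inr v` (its formal inverse). The integer matrix `A` is *twice* the half-integral matrix `Q`,
the unit `s` is the chosen square root of the quantum parameter, so that the commutation relation
reads `Z_v Z_w = (s ^ 2) ^ (2 Q(v,w)) Z_w Z_v`. -/
inductive TorusRel (A : V → V → ℤ) (s : ℂˣ) :
    FreeAlgebra ℂ (V ⊕ V) → FreeAlgebra ℂ (V ⊕ V) → Prop
  | mul_inv (v : V) :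
      TorusRel A s (FreeAlgebra.ι ℂ (Sum.inl v) * FreeAlgebra.ι ℂ (Sum.inr v)) 1
  | inv_mul (v : V) :
      TorusRel A s (FreeAlgebra.ι ℂ (Sum.inr v) * FreeAlgebra.ι ℂ (Sum.inl v)) 1
  | comm (v w : V) :
      TorusRel A s (FreeAlgebra.ι ℂ (Sum.inl v) * FreeAlgebra.ι ℂ (Sum.inl w))
        ((((s ^ 2) ^ A v w : ℂˣ) : ℂ) •
          (FreeAlgebra.ι ℂ (Sum.inl w) * FreeAlgebra.ι ℂ (Sum.inl v)))

/-- The quantum torus `ℂ⟨Z_v^{±1}⟩ / (Z_v Z_w = (s^2)^{A(v,w)} Z_w Z_v)`, where `A = 2 Q`. -/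
abbrev QuantumTorus (A : V → V → ℤ) (s : ℂˣ) : Type _ :=
  RingQuot (TorusRel A s)

/-- The invertible generator `Z_v`. -/
def torusGen (A : V → V → ℤ) (s : ℂˣ) (v : V) : (QuantumTorus A s)ˣ where
  val := RingQuot.mkAlgHom ℂ (TorusRel A s) (FreeAlgebra.ι ℂ (Sum.inl v))
  inv := RingQuot.mkAlgHom ℂ (TorusRel A s) (FreeAlgebra.ι ℂ (Sum.inr v))
  val_inv := by
    rw [← map_mul, RingQuot.mkAlgHom_rel ℂ (TorusRel.mul_inv v), map_one]
  inv_val := by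
    rw [← map_mul, RingQuot.mkAlgHom_rel ℂ (TorusRel.inv_mul v), map_one]

/-- For a list `v_1, …, v_r`: the integer `∑_{i<j} t(v_i) t(v_j) A(v_i, v_j)`. -/
def weylExponent (A : V → V → ℤ) (t : V → ℤ) : List V → ℤ
  | [] => 0
  | v :: l => (l.map fun w => t v * t w * A v w).sum + weylExponent A t l

/-- For a list `v_1, …, v_r`: the ordered product `Z_{v_1}^{t(v_1)} ⋯ Z_{v_r}^{t(v_r)}`. -/
def orderedProduct (A : V → V → ℤ) (s : ℂˣ) (t : V → ℤ) (l : List V) : (QuantumTorus A s)ˣ :=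
  (l.map fun v => torusGen A s v ^ t v).prod

/-- The Weyl-ordered Laurent monomial
`Z^t = (s^2)^{-∑_{i<j} t(v_i) t(v_j) Q(v_i,v_j)} Z_{v_1}^{t(v_1)} ⋯ Z_{v_r}^{t(v_r)}`,
computed along an arbitrary enumeration `v_1, …, v_r` of `V`. Here `Q = A / 2`, whence
the scalar is the corresponding power of `s`. The result does not depend on the enumeration when
`A` is antisymmetric. -/
noncomputable def weylMonomial [Fintype V] (A : V → V → ℤ) (s : ℂˣ) (t : V → ℤ) :
    QuantumTorus A s :=
  ((s ^ (-weylExponent A t Finset.univ.toList) : ℂˣ) : ℂ) •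
    ((orderedProduct A s t Finset.univ.toList : (QuantumTorus A s)ˣ) : QuantumTorus A s)

/-- Two units `x`, `y` of a `ℂ`-algebra commute up to a nonzero scalar. -/
def QuasiCommute {R : Type*} [Ring R] [Algebra ℂ R] (x y : Rˣ) : Prop :=
  ∃ c : ℂˣ, x * y = Units.map (algebraMap ℂ R).toMonoidHom c * (y * x)

section QuasiCommute

variable {R : Type*} [Ring R] [Algebra ℂ R]

theorem scalarUnit_comm (c : ℂˣ) (x : Rˣ) :
    x * Units.map (algebraMap ℂ R).toMonoidHom c =
      Units.map (algebraMap ℂ R).toMonoidHom c * x := by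
  ext
  simpa using (Algebra.commutes (c : ℂ) (x : R)).symm

theorem QuasiCommute.symm {x y : Rˣ} (h : QuasiCommute x y) : QuasiCommute y x := by
  obtain ⟨c, hc⟩ := h
  refine ⟨c⁻¹, ?_⟩
  rw [hc, ← mul_assoc, ← map_mul, inv_mul_cancel, map_one, one_mul]

theorem QuasiCommute.one_right (x : Rˣ) : QuasiCommute x 1 := ⟨1, by simp⟩

theorem QuasiCommute.mul_right {x y z : Rˣ} (hy : QuasiCommute x y) (hz : QuasiCommute x z) :
    QuasiCommute x (y * z) := by
  obtain ⟨c, hc⟩ := hy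
  obtain ⟨d, hd⟩ := hz
  refine ⟨c * d, ?_⟩
  rw [← mul_assoc, hc, mul_assoc, mul_assoc, hd, map_mul, ← mul_assoc y, scalarUnit_comm d y]
  simp only [mul_assoc]

theorem QuasiCommute.inv_right {x y : Rˣ} (h : QuasiCommute x y) : QuasiCommute x y⁻¹ := by
  obtain ⟨c, hc⟩ := h.symm
  refine ⟨c, ?_⟩
  have h2 : y⁻¹ * (y * x) * y⁻¹ =
      y⁻¹ * (Units.map (algebraMap ℂ R).toMonoidHom c * (x * y)) * y⁻¹ := by rw [hc]
  rw [← mul_assoc, inv_mul_cancel, one_mul, ← mul_assoc, scalarUnit_comm] at h2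
  rw [h2]
  simp only [mul_assoc, mul_inv_cancel, mul_one]

theorem QuasiCommute.zpow_right {x y : Rˣ} (h : QuasiCommute x y) (a : ℤ) :
    QuasiCommute x (y ^ a) := by
  induction a using Int.induction_on with
  | zero => simpa using QuasiCommute.one_right x
  | succ k ih => rw [zpow_add_one]; exact ih.mul_right h
  | pred k ih => rw [zpow_sub_one]; exact ih.mul_right h.inv_right

theorem QuasiCommute.list_prod_right {ι : Type*} {x : Rˣ} (f : ι → Rˣ) (l : List ι)
    (h : ∀ i, QuasiCommute x (f i)) : QuasiCommute x (l.map f).prod := by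
  induction l with
  | nil => simpa using QuasiCommute.one_right x
  | cons i l ih => rw [List.map_cons, List.prod_cons]; exact (h i).mul_right ih

end QuasiCommute

theorem torusGen_quasiCommute (A : V → V → ℤ) (s : ℂˣ) (v w : V) :
    QuasiCommute (torusGen A s v) (torusGen A s w) := by
  refine ⟨(s ^ 2) ^ A v w, ?_⟩
  ext
  have h := RingQuot.mkAlgHom_rel ℂ (TorusRel.comm (A := A) (s := s) v w)
  rw [map_mul, map_smul, map_mul, Algebra.smul_def] at h
  exact h

theorem orderedProduct_mul (A : V → V → ℤ) (s : ℂˣ) (k t : V → ℤ) (l : List V) :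
    ∃ c : ℂˣ, orderedProduct A s k l * orderedProduct A s t l =
      Units.map (algebraMap ℂ (QuantumTorus A s)).toMonoidHom c *
        orderedProduct A s (k + t) l := by
  induction l with
  | nil => exact ⟨1, by simp [orderedProduct]⟩
  | cons v l ih =>
    obtain ⟨c, hc⟩ := ih
    have hq : QuasiCommute (orderedProduct A s k l) (torusGen A s v ^ t v) := by
      refine QuasiCommute.zpow_right (QuasiCommute.symm ?_) _
      exact QuasiCommute.list_prod_right _ _
        fun w => (torusGen_quasiCommute A s v w).zpow_right _
    obtain ⟨d, hd⟩ := hq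
    refine ⟨d * c, ?_⟩
    have e : ∀ r : V → ℤ, orderedProduct A s r (v :: l) =
        torusGen A s v ^ r v * orderedProduct A s r l := fun r => by simp [orderedProduct]
    rw [e, e, e]
    calc torusGen A s v ^ k v * orderedProduct A s k l *
          (torusGen A s v ^ t v * orderedProduct A s t l)
        = torusGen A s v ^ k v * (orderedProduct A s k l * torusGen A s v ^ t v) *
            orderedProduct A s t l := by simp only [mul_assoc]
      _ = torusGen A s v ^ k v * Units.map (algebraMap ℂ (QuantumTorus A s)).toMonoidHom d *
            torusGen A s v ^ t v * (orderedProduct A s k l * orderedProduct A s t l) := by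
          rw [hd]; simp only [mul_assoc]
      _ = _ := by
          rw [hc, scalarUnit_comm, map_mul, Pi.add_apply, zpow_add]
          simp only [mul_assoc]
          rw [← mul_assoc (torusGen A s v ^ t v), scalarUnit_comm]
          simp only [mul_assoc]
          rw [← mul_assoc (torusGen A s v ^ k v)
            (Units.map (algebraMap ℂ (QuantumTorus A s)).toMonoidHom c), scalarUnit_comm]
          simp only [mul_assoc]

theorem weylMonomial_mul [Fintype V] (A : V → V → ℤ) (s : ℂˣ) (k t : V → ℤ) :
    ∃ c : ℂ, weylMonomial A s k * weylMonomial A s t = c • weylMonomial A s (k + t) := by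
  obtain ⟨c, hc⟩ := orderedProduct_mul A s k t Finset.univ.toList
  have hc' := congrArg (fun u : (QuantumTorus A s)ˣ => (u : QuantumTorus A s)) hc
  simp only [Units.val_mul, Units.coe_map] at hc'
  have hc2 : ((orderedProduct A s k Finset.univ.toList : (QuantumTorus A s)ˣ) : QuantumTorus A s)
      * ((orderedProduct A s t Finset.univ.toList : (QuantumTorus A s)ˣ) : QuantumTorus A s)
      = (c : ℂ) • ((orderedProduct A s (k + t) Finset.univ.toList : (QuantumTorus A s)ˣ) :
        QuantumTorus A s) := by
    rw [hc', Algebra.smul_def]; rfl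
  refine ⟨((s ^ (-weylExponent A k Finset.univ.toList) : ℂˣ) : ℂ) *
    ((s ^ (-weylExponent A t Finset.univ.toList) : ℂˣ) : ℂ) * c *
    ((s ^ (weylExponent A (k + t) Finset.univ.toList) : ℂˣ) : ℂ), ?_⟩
  unfold weylMonomial
  rw [smul_mul_smul_comm, hc2, smul_smul, smul_smul]
  congr 1
  rw [mul_assoc (_ * _), ← Units.val_mul (s ^ weylExponent A (k + t) Finset.univ.toList),
    ← zpow_add, add_neg_cancel, zpow_zero, Units.val_one, mul_one]

theorem weylMonomial_zero [Fintype V] (A : V → V → ℤ) (s : ℂˣ) : weylMonomial A s 0 = 1 := by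
  have h : ∀ l : List V, weylExponent A 0 l = 0 := by
    intro l
    induction l with
    | nil => rfl
    | cons v l ih => simp [weylExponent, ih]
  simp [weylMonomial, h, orderedProduct]

/-- The monomial subalgebra `span_ℂ {Z^k | k ∈ Λ}` attached to a subgroup `Λ` of `ℤ^V`. -/
noncomputable def monomialSubalgebra [Fintype V] (A : V → V → ℤ) (s : ℂˣ)
    (Λ : AddSubgroup (V → ℤ)) : Subalgebra ℂ (QuantumTorus A s) :=
  (Submodule.span ℂ (weylMonomial A s '' (Λ : Set (V → ℤ)))).toSubalgebra
    (Submodule.subset_span ⟨0, Λ.zero_mem, weylMonomial_zero A s⟩)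
    (by
      intro x y hx hy
      have h := Submodule.mul_mem_mul hx hy
      rw [Submodule.span_mul_span] at h
      refine Submodule.span_le.2 ?_ h
      rintro _ ⟨_, ⟨k, hk, rfl⟩, _, ⟨t, ht, rfl⟩, rfl⟩
      obtain ⟨c, hc⟩ := weylMonomial_mul A s k t
      have : weylMonomial A s k * weylMonomial A s t ∈
          Submodule.span ℂ (weylMonomial A s '' (Λ : Set (V → ℤ))) := by
        rw [hc]
        exact Submodule.smul_mem _ _ (Submodule.subset_span ⟨k + t, Λ.add_mem hk ht, rfl⟩)
      exact this)

end QuantumTorus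

/-! ### The `n`-triangulated ideal triangle

The three ideal vertices are indexed by `Fin 3` (arithmetic modulo `3`), in clockwise order. Edge `j`
joins the ideal vertices `j` and `j + 1`, i.e. it is the locus where coordinate `j + 2` vanishes. -/

/-- Small vertices of the triangle: points with natural barycentric coordinates of sum `n`, other
than the three ideal vertices. -/
abbrev SmallVertex (n : ℕ) : Type :=
  {u : Fin 3 → ℕ // u 0 + u 1 + u 2 = n ∧ ∀ j, u j ≠ n}

instance (n : ℕ) : Finite (SmallVertex n) := by
  have h : ∀ (u : SmallVertex n) (j : Fin 3), u.1 j < n + 1 := by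
    rintro ⟨u, hu, -⟩ j
    fin_cases j <;> simp <;> omega
  refine Finite.of_injective (fun u j => (⟨u.1 j, h u j⟩ : Fin (n + 1))) ?_
  intro u u' huu
  ext j
  simpa using congrFun huu j

noncomputable instance (n : ℕ) : Fintype (SmallVertex n) := Fintype.ofFinite _

/-- The admissible indices `1 ≤ i ≤ n - 1`. -/
abbrev Level (n : ℕ) : Type := {i : ℕ // 1 ≤ i ∧ i < n}

/-- There is an arrow from `u` to `u'` parallel to edge `j`. Arrows run counterclockwise, i.e.
parallel to edge `j` they go from ideal vertex `j + 1` towards ideal vertex `j`. -/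
def IsArrow {n : ℕ} (j : Fin 3) (u u' : SmallVertex n) : Prop :=
  u'.1 j = u.1 j + 1 ∧ u'.1 (j + 1) + 1 = u.1 (j + 1) ∧ u'.1 (j + 2) = u.1 (j + 2)

open Classical in
/-- Twice the weight of the arrow from `u` to `u'` (zero if there is none): boundary arrows have
weight `1/2`, interior arrows have weight `1`. An arrow parallel to edge `j` is a boundary arrow
exactly when it lies on edge `j`. -/
noncomputable def twiceWeight {n : ℕ} (u u' : SmallVertex n) : ℤ :=
  ∑ j : Fin 3, if IsArrow j u u' then (if u.1 (j + 2) = 0 then 1 else 2) else 0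

/-- Twice the signed adjacency matrix of the weighted quiver of the triangle. -/
noncomputable def twiceQTriangle {n : ℕ} (u u' : SmallVertex n) : ℤ :=
  twiceWeight u u' - twiceWeight u' u

/-- The coordinate function `k_j` on the small vertices. -/
def coord {n : ℕ} (j : Fin 3) (u : SmallVertex n) : ℤ := u.1 j

/-- The balanced part of `ℤ^{V}` for the triangle: the subgroup generated by the three coordinate
functions and `(nℤ)^{V}`. -/
def balancedTriangle (n : ℕ) : AddSubgroup (SmallVertex n → ℤ) :=
  AddSubgroup.closure (Set.range coord ∪ {k | ∀ u, (n : ℤ) ∣ k u})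

/-- The vector `a(τ, v_j, i)`: the indicator of the small vertices whose `j`-th coordinate is
`n - i`. -/
def aTriangle {n : ℕ} (j : Fin 3) (i : ℕ) (u : SmallVertex n) : ℤ :=
  if u.1 j + i = n then 1 else 0

/-- The vector `b(τ, v_j, i) = ∑_{1 ≤ t ≤ n-i-1} n (t + i - n) a(τ, v_j, t) + (n - i) k_j`. -/
def bTriangle {n : ℕ} (j : Fin 3) (i : ℕ) (u : SmallVertex n) : ℤ :=
  (∑ t ∈ Finset.Ico 1 (n - i), (n : ℤ) * ((t : ℤ) + i - n) * aTriangle j t u)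
    + ((n : ℤ) - i) * coord j u

theorem bTriangle_congr {n : ℕ} {j j' : Fin 3} {i : ℕ} {u u' : SmallVertex n}
    (h : u.1 j = u'.1 j') : bTriangle j i u = bTriangle j' i u' := by
  simp [bTriangle, aTriangle, coord, h]

theorem bTriangle_eq_zero {n : ℕ} {j : Fin 3} {i : ℕ} {u : SmallVertex n}
    (h : u.1 j = 0) : bTriangle j i u = 0 := by
  simp only [bTriangle, aTriangle, coord, h, zero_add, Nat.cast_zero, mul_zero, add_zero]
  refine Finset.sum_eq_zero fun t ht => ?_
  rw [Finset.mem_Ico] at ht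
  rw [if_neg (by omega), mul_zero]

/-! ### Triangulated punctured surfaces -/

/-- An ideal triangulation, without self-folded triangles, of an oriented punctured surface without
boundary, with set of faces `F`. Each face is a copy of the oriented ideal triangle. The pair
`(τ, j)` stands for edge `j` of face `τ`, and `glue` is the pairing of the edges of the faces. Edge
`(τ, j)` is glued to edge `(τ', j') = glue (τ, j)` by the orientation reversing affine
identification, which matches the ideal vertices `j`, `j + 1` of `τ` with the ideal vertices
`j' + 1`, `j'` of `τ'`. In an oriented gluing, two edges of one face can only be
glued by folding the face, so the absence of self-folded triangles means that every edge has
two different faces on its sides. -/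
structure IdealTriangulation (F : Type*) where
  glue : F × Fin 3 → F × Fin 3
  glue_glue : ∀ e, glue (glue e) = e
  not_selfFolded : ∀ e, (glue e).1 ≠ e.1

namespace IdealTriangulation

variable {F : Type*} (T : IdealTriangulation F)

/-- The identification of small vertices on glued edges. -/
def GlueVertex (n : ℕ) (x y : F × SmallVertex n) : Prop :=
  ∃ j j' : Fin 3, T.glue (x.1, j) = (y.1, j') ∧ x.2.1 (j + 2) = 0 ∧ y.2.1 (j' + 2) = 0 ∧
    y.2.1 j' = x.2.1 (j + 1) ∧ y.2.1 (j' + 1) = x.2.1 j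

/-- The identification of ideal vertices at the ends of glued edges. -/
def GlueCorner (x y : F × Fin 3) : Prop :=
  ∃ j j' : Fin 3, T.glue (x.1, j) = (y.1, j') ∧
    ((x.2 = j ∧ y.2 = j' + 1) ∨ (x.2 = j + 1 ∧ y.2 = j'))

/-- The set `V_λ` of small vertices of the `n`-triangulation of the surface. -/
def Vertex (n : ℕ) : Type _ := Quot (T.GlueVertex n)

/-- The set of punctures of the surface. -/
def Puncture : Type _ := Quot T.GlueCorner

/-- The characteristic map of the face `τ` on small vertices. -/
def vertex {n : ℕ} (τ : F) (u : SmallVertex n) : T.Vertex n := Quot.mk _ (τ, u)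

/-- The puncture at the ideal vertex `j` of the face `τ`. -/
def puncture (τ : F) (j : Fin 3) : T.Puncture := Quot.mk _ (τ, j)

instance [Finite F] (n : ℕ) : Finite (T.Vertex n) :=
  inferInstanceAs (Finite (Quot (T.GlueVertex n)))

noncomputable instance [Finite F] (n : ℕ) : Fintype (T.Vertex n) := Fintype.ofFinite _

open Classical in
/-- Twice the signed adjacency matrix `Q_λ` of the weighted quiver obtained by gluing the
quivers of the faces (the weights of parallel arrows are added, those of opposite arrows cancel). -/
noncomputable def twiceQ [Fintype F] (n : ℕ) (v w : T.Vertex n) : ℤ :=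
  ∑ τ : F, ∑ u : SmallVertex n, ∑ u' : SmallVertex n,
    if T.vertex τ u = v ∧ T.vertex τ u' = w then twiceQTriangle u u' else 0

/-- The signed adjacency matrix `Q_λ`. -/
noncomputable def Q [Fintype F] (n : ℕ) : Matrix (T.Vertex n) (T.Vertex n) ℚ :=
  fun v w => (T.twiceQ n v w : ℚ) / 2

/-- The number `k Q_λ tᵀ`. -/
noncomputable def form [Fintype F] (n : ℕ) (k t : T.Vertex n → ℤ) : ℚ :=
  ∑ v, ∑ w, (k v : ℚ) * T.Q n v w * (t w : ℚ)

/-- The pullback of vectors along the characteristic map of the face `τ`. -/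
def pullback (n : ℕ) (τ : F) : (T.Vertex n → ℤ) →+ (SmallVertex n → ℤ) where
  toFun k u := k (T.vertex τ u)
  map_zero' := rfl
  map_add' _ _ := rfl

/-- The group `B_λ` of balanced vectors: those whose pullbacks to all faces are balanced. -/
def balanced (n : ℕ) : AddSubgroup (T.Vertex n → ℤ) :=
  ⨅ τ : F, (balancedTriangle n).comap (T.pullback n τ)

open Classical in
/-- The vector `b(λ, p, i)`: its pullback to the face `τ` is the sum of the vectors
`b(τ, v_j, i)` over the ideal vertices `v_j` of `τ` which are located at `p`. -/
noncomputable def b (n : ℕ) (p : T.Puncture) (i : Level n) : T.Vertex n → ℤ :=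
  Quot.lift
    (fun x : F × SmallVertex n =>
      ∑ j : Fin 3, if T.puncture x.1 j = p then bTriangle j i.1 x.2 else 0)
    (by
      rintro ⟨τ, u⟩ ⟨τ', u'⟩ ⟨j, j', hg, h0, h0', h1, h2⟩
      have e : ∀ (f : Fin 3 → ℤ) (m : Fin 3), ∑ l, f l = f m + f (m + 1) + f (m + 2) := by
        intro f m
        rw [Fin.sum_univ_three]
        fin_cases m
        · rfl
        · change f 0 + f 1 + f 2 = f 1 + f 2 + f 0
          ring
        · change f 0 + f 1 + f 2 = f 2 + f 0 + f 1
          ring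
      have p1 : T.puncture τ j = T.puncture τ' (j' + 1) :=
        Quot.sound ⟨j, j', hg, Or.inl ⟨rfl, rfl⟩⟩
      have p2 : T.puncture τ (j + 1) = T.puncture τ' j' :=
        Quot.sound ⟨j, j', hg, Or.inr ⟨rfl, rfl⟩⟩
      dsimp only at h0 h0' h1 h2 ⊢
      rw [e _ j, e _ j', p1, p2, bTriangle_eq_zero h0, bTriangle_eq_zero h0',
        bTriangle_congr (i := i.1) h1, bTriangle_congr (i := i.1) h2]
      simp only [ite_self, add_zero]
      rw [add_comm])

/-- The balanced Fock–Goncharov algebra `span_ℂ {Z^k | k ∈ B_λ}`, a subalgebra of the `n`-th root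
Fock–Goncharov algebra, which is the quantum torus of `Q_λ` with parameter `s ^ 2`. -/
noncomputable def balancedAlgebra [Fintype F] (n : ℕ) (s : ℂˣ) :
    Subalgebra ℂ (QuantumTorus (T.twiceQ n) s) :=
  monomialSubalgebra (T.twiceQ n) s (T.balanced n)

end IdealTriangulation

end FockGoncharov

/-!
The radical of the form, the kernel of `Q_λ` on balanced vectors, is a discrete Dirichlet problem.
Extend a vector `k` on a face by zero to the ideal vertices. At an interior small vertex, `k Q` is
up to sign the product of the three difference operators in the edge directions, applied to `k`.
Hence `k Q = 0` there says that the alternating sum of `k` over a rhombus at the ideal vertex `j`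
(`rhombus`, a product of two of the difference operators) depends only on the coordinate `j` of the
rhombus (`rhombus_slide`). If `k = ∑ H_j(x_j)` with each `H_j` zero at `0` and `n`, the rhombus sum
is the second difference of `H_j`.

On an edge with end points `j` and `j + 1`, the contribution of a face to `2 k Q` is `D - 2 R_j`,
where `R_j` is the rhombus sum at `j` and `D = R_j + R_{j+1}` is the second difference of the values
along the edge (`twiceFlow_edge_eq_rhombus`, `rhombus_add_rhombus`). The values along the edge are
those of the neighbouring face, so `k Q = 0` on the edge says that the rhombus sums at identified
ideal vertices agree (`rhombus_eq_of_glue`): they are functions of the puncture and of the level.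

The vector `b(λ, p, i)` is the sum, over the corners at `p`, of the tent function with its kink at
`i`; as `-n` times a delta function is its second difference (`tent_second_difference`), it lies in
the kernel and its rhombus sums are `-n` at `(p, i)` and zero elsewhere. This gives linear
independence. For a balanced vector all rhombus sums are divisible by `n`, because those of
coordinate functions vanish modulo `n` (`dvd_rhombus_of_balanced`). Subtracting an integral
combination of the `b(λ, p, i)` therefore kills all rhombus sums, and a vector without rhombus sums
is affine on each face and zero at the ideal vertices, hence zero (`eq_zero_of_rhombus`).

For the center, the quantum torus acts on the vector space with basis `ℤ^V` by twisted shifts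
(`torusRep`). The Weyl-ordered monomial `Z^t` acts exactly by the shift operator of `t`, which shows
that the monomials are linearly independent and that `Z^k Z^t = s^{2 k Q tᵀ} Z^{k + t}`. If `s` is
not a root of unity, the center of the span of the `Z^k`, `k ∈ Λ`, is the span of the `Z^k` with `k`
in the radical, and there the product is that of the group algebra of the radical
(`exists_algEquiv_center`).
-/

namespace FockGoncharov

/-! ### Functions on the small vertices of a triangle -/

section Triangle

/-- The point whose barycentric coordinates at the ideal vertices `j`, `j + 1`, `j + 2` are
`x`, `y`, `z`. -/
def barycentric (j : Fin 3) (x y z : ℕ) : Fin 3 → ℕ :=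
  fun l => if l = j then x else if l = j + 1 then y else z

theorem barycentric_rotate (j : Fin 3) (x y z : ℕ) :
    barycentric (j + 1) y z x = barycentric j x y z := by
  funext l
  fin_cases j <;> fin_cases l <;> rfl

@[simp] theorem barycentric_zero (j : Fin 3) (x y z : ℕ) : barycentric j x y z j = x := by
  simp [barycentric]

@[simp] theorem barycentric_one (j : Fin 3) (x y z : ℕ) : barycentric j x y z (j + 1) = y := by
  fin_cases j <;> rfl

@[simp] theorem barycentric_two (j : Fin 3) (x y z : ℕ) : barycentric j x y z (j + 2) = z := by
  fin_cases j <;> rfl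

theorem barycentric_self (j : Fin 3) (u : Fin 3 → ℕ) :
    barycentric j (u j) (u (j + 1)) (u (j + 2)) = u := by
  funext l
  fin_cases j <;> fin_cases l <;> rfl

theorem forall_fin_three (j : Fin 3) {P : Fin 3 → Prop} :
    (∀ l, P l) ↔ P j ∧ P (j + 1) ∧ P (j + 2) := by
  fin_cases j
  · exact ⟨fun h => ⟨h _, h _, h _⟩, fun h l => by fin_cases l; exacts [h.1, h.2.1, h.2.2]⟩
  · exact ⟨fun h => ⟨h _, h _, h _⟩, fun h l => by fin_cases l; exacts [h.2.2, h.1, h.2.1]⟩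
  · exact ⟨fun h => ⟨h _, h _, h _⟩, fun h l => by fin_cases l; exacts [h.2.1, h.2.2, h.1]⟩

theorem sum_fin_three {M : Type*} [AddCommMonoid M] (j : Fin 3) (f : Fin 3 → M) :
    ∑ l, f l = f j + f (j + 1) + f (j + 2) := by
  rw [Fin.sum_univ_three]
  fin_cases j
  · rfl
  · change f 0 + f 1 + f 2 = f 1 + f 2 + f 0
    abel
  · change f 0 + f 1 + f 2 = f 2 + f 0 + f 1
    abel

variable {n : ℕ}

theorem isSmallVertex_barycentric {j : Fin 3} {x y z : ℕ} :
    (barycentric j x y z 0 + barycentric j x y z 1 + barycentric j x y z 2 = n ∧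
      ∀ l, barycentric j x y z l ≠ n) ↔ x + y + z = n ∧ x ≠ n ∧ y ≠ n ∧ z ≠ n := by
  rw [forall_fin_three j, ← Fin.sum_univ_three, sum_fin_three j]
  simp

theorem SmallVertex.sum_eq (u : SmallVertex n) (j : Fin 3) :
    u.1 j + u.1 (j + 1) + u.1 (j + 2) = n := by
  rw [← sum_fin_three j, Fin.sum_univ_three]
  exact u.2.1

open Classical in
/-- The value of a function on the small vertices at the point with barycentric coordinates
`x`, `y`, `z` at the ideal vertices `j`, `j + 1`, `j + 2`. It is set to zero at the ideal vertices
(and outside of the triangle), which is what makes the formulas below uniform up to the corners. -/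
noncomputable def value (j : Fin 3) (x y z : ℕ) : (SmallVertex n → ℤ) →+ ℤ where
  toFun f := if h : _ then f ⟨barycentric j x y z, isSmallVertex_barycentric.2 h⟩ else 0
  map_zero' := by simp
  map_add' f g := by split_ifs <;> simp

theorem value_of_valid {j : Fin 3} {x y z : ℕ} (h : x + y + z = n ∧ x ≠ n ∧ y ≠ n ∧ z ≠ n)
    (f : SmallVertex n → ℤ) :
    value j x y z f = f ⟨barycentric j x y z, isSmallVertex_barycentric.2 h⟩ :=
  dif_pos h

theorem value_of_not_valid {j : Fin 3} {x y z : ℕ}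
    (h : ¬ (x + y + z = n ∧ x ≠ n ∧ y ≠ n ∧ z ≠ n)) (f : SmallVertex n → ℤ) :
    value j x y z f = 0 :=
  dif_neg h

theorem value_rotate (j : Fin 3) (x y z : ℕ) (f : SmallVertex n → ℤ) :
    value (j + 1) y z x f = value j x y z f := by
  by_cases h : x + y + z = n ∧ x ≠ n ∧ y ≠ n ∧ z ≠ n
  · rw [value_of_valid h, value_of_valid (by omega)]
    simp only [barycentric_rotate]
  · rw [value_of_not_valid h, value_of_not_valid (by omega)]

theorem value_rotate_two (j : Fin 3) (x y z : ℕ) (f : SmallVertex n → ℤ) :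
    value (j + 2) z x y f = value j x y z f := by
  rw [← value_rotate j, ← value_rotate (j + 1), add_assoc]
  rfl

theorem SmallVertex.valid (u : SmallVertex n) (j : Fin 3) :
    u.1 j + u.1 (j + 1) + u.1 (j + 2) = n ∧ u.1 j ≠ n ∧ u.1 (j + 1) ≠ n ∧ u.1 (j + 2) ≠ n :=
  ⟨u.sum_eq j, u.2.2 _, u.2.2 _, u.2.2 _⟩

theorem value_coords (u : SmallVertex n) (j : Fin 3) (f : SmallVertex n → ℤ) :
    value j (u.1 j) (u.1 (j + 1)) (u.1 (j + 2)) f = f u := by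
  rw [value_of_valid (u.valid j)]
  simp only [barycentric_self]

theorem SmallVertex.ext_coords {u u' : SmallVertex n} (j : Fin 3) (h0 : u.1 j = u'.1 j)
    (h1 : u.1 (j + 1) = u'.1 (j + 1)) (h2 : u.1 (j + 2) = u'.1 (j + 2)) : u = u' := by
  apply Subtype.ext
  rw [← barycentric_self j u.1, ← barycentric_self j u'.1, h0, h1, h2]

/-- `(f Q)(u)`, doubled: the contribution of a single triangle to `2 k Q_λ` at one of its small
vertices. -/
noncomputable def twiceFlow (f : SmallVertex n → ℤ) (u : SmallVertex n) : ℤ :=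
  ∑ u', f u' * twiceQTriangle u' u

open Classical in
theorem sum_isArrow_in (j : Fin 3) (u : SmallVertex n) (f : SmallVertex n → ℤ) :
    ∑ u', (if IsArrow j u' u then f u' else 0) =
      if 1 ≤ u.1 j then value j (u.1 j - 1) (u.1 (j + 1) + 1) (u.1 (j + 2)) f else 0 := by
  have hs := u.valid j
  split_ifs with h0
  · by_cases hv : (u.1 j - 1) + (u.1 (j + 1) + 1) + (u.1 (j + 2)) = n ∧ u.1 j - 1 ≠ n ∧
        u.1 (j + 1) + 1 ≠ n ∧ u.1 (j + 2) ≠ n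
    · rw [value_of_valid hv, Finset.sum_eq_single_of_mem _ (Finset.mem_univ _), if_pos]
      · refine ⟨?_, ?_, ?_⟩ <;> simp
        omega
      · rintro u' - hne
        rw [if_neg]
        rintro ⟨h1, h2, h3⟩
        refine hne (SmallVertex.ext_coords j ?_ ?_ ?_) <;> simp <;> omega
    · rw [value_of_not_valid hv]
      refine Finset.sum_eq_zero fun u' _ => if_neg ?_
      rintro ⟨h1, h2, h3⟩
      have := u'.valid j
      omega
  · refine Finset.sum_eq_zero fun u' _ => if_neg ?_
    rintro ⟨h1, h2, h3⟩
    omega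

open Classical in
theorem sum_isArrow_out (j : Fin 3) (u : SmallVertex n) (f : SmallVertex n → ℤ) :
    ∑ u', (if IsArrow j u u' then f u' else 0) =
      if 1 ≤ u.1 (j + 1) then value j (u.1 j + 1) (u.1 (j + 1) - 1) (u.1 (j + 2)) f else 0 := by
  have hs := u.valid j
  split_ifs with h0
  · by_cases hv : (u.1 j + 1) + (u.1 (j + 1) - 1) + (u.1 (j + 2)) = n ∧ u.1 j + 1 ≠ n ∧
        u.1 (j + 1) - 1 ≠ n ∧ u.1 (j + 2) ≠ n
    · rw [value_of_valid hv, Finset.sum_eq_single_of_mem _ (Finset.mem_univ _), if_pos]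
      · refine ⟨?_, ?_, ?_⟩ <;> simp
        omega
      · rintro u' - hne
        rw [if_neg]
        rintro ⟨h1, h2, h3⟩
        refine hne (SmallVertex.ext_coords j ?_ ?_ ?_) <;> simp <;> omega
    · rw [value_of_not_valid hv]
      refine Finset.sum_eq_zero fun u' _ => if_neg ?_
      rintro ⟨h1, h2, h3⟩
      have := u'.valid j
      omega
  · refine Finset.sum_eq_zero fun u' _ => if_neg ?_
    rintro ⟨h1, h2, h3⟩
    omega

theorem twiceFlow_eq (f : SmallVertex n → ℤ) (u : SmallVertex n) :
    twiceFlow f u = ∑ j : Fin 3, (if u.1 (j + 2) = 0 then 1 else 2) *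
      ((if 1 ≤ u.1 j then value j (u.1 j - 1) (u.1 (j + 1) + 1) (u.1 (j + 2)) f else 0) -
        if 1 ≤ u.1 (j + 1) then value j (u.1 j + 1) (u.1 (j + 1) - 1) (u.1 (j + 2)) f else 0) := by
  classical
  simp only [← sum_isArrow_in, ← sum_isArrow_out, twiceFlow, twiceQTriangle, twiceWeight,
    mul_sub, Finset.sum_sub_distrib, Finset.mul_sum]
  congr 1
  · rw [Finset.sum_comm]
    refine Finset.sum_congr rfl fun j _ => Finset.sum_congr rfl fun u' _ => ?_
    by_cases h : IsArrow j u' u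
    · rw [if_pos h, if_pos h, h.2.2, mul_comm]
    · rw [if_neg h, if_neg h, mul_zero, mul_zero]
  · rw [Finset.sum_comm]
    refine Finset.sum_congr rfl fun j _ => Finset.sum_congr rfl fun u' _ => ?_
    split_ifs <;> ring

/-- At an interior small vertex the flow is the alternating sum over the surrounding hexagon. -/
theorem twiceFlow_interior (f : SmallVertex n → ℤ) {u : SmallVertex n} {j : Fin 3} {x y z : ℕ}
    (hx : u.1 j = x + 1) (hy : u.1 (j + 1) = y + 1) (hz : u.1 (j + 2) = z + 1) :
    twiceFlow f u = 2 * (value j x (y + 2) (z + 1) f - value j (x + 2) y (z + 1) f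
      + value j (x + 1) y (z + 2) f - value j (x + 1) (y + 2) z f
      + value j (x + 2) (y + 1) z f - value j x (y + 1) (z + 2) f) := by
  have e1 : j + 1 + 1 = j + 2 := by rw [add_assoc]; rfl
  have e2 : j + 1 + 2 = j := by rw [add_assoc]; exact add_zero j
  have e3 : j + 2 + 1 = j := by rw [add_assoc]; exact add_zero j
  have e4 : j + 2 + 2 = j + 1 := by rw [add_assoc]; rfl
  rw [twiceFlow_eq, sum_fin_three j]
  simp [e1, e2, e3, e4, hx, hy, hz, value_rotate, value_rotate_two]
  ring

/-- At a small vertex on edge `j` the arrows along the edge count half. -/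
theorem twiceFlow_edge (f : SmallVertex n → ℤ) {u : SmallVertex n} {j : Fin 3} {x y : ℕ}
    (hx : u.1 j = x + 1) (hy : u.1 (j + 1) = y + 1) (hz : u.1 (j + 2) = 0) :
    twiceFlow f u = value j x (y + 2) 0 f - value j (x + 2) y 0 f
      + 2 * value j (x + 1) y 1 f - 2 * value j x (y + 1) 1 f := by
  have e1 : j + 1 + 1 = j + 2 := by rw [add_assoc]; rfl
  have e2 : j + 1 + 2 = j := by rw [add_assoc]; exact add_zero j
  have e3 : j + 2 + 1 = j := by rw [add_assoc]; exact add_zero j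
  have e4 : j + 2 + 2 = j + 1 := by rw [add_assoc]; rfl
  rw [twiceFlow_eq, sum_fin_three j]
  simp [e1, e2, e3, e4, hx, hy, hz, value_rotate, value_rotate_two]
  ring

/-- The alternating sum of `f` over a rhombus with two sides on lines where the coordinate `j + 1`
is constant and two sides on lines where the coordinate `j + 2` is constant. It kills the functions
of the coordinate `j + 1` and those of the coordinate `j + 2`, and takes a function of the
coordinate `j` to its second difference at `x + 1`. -/
noncomputable def rhombus (j : Fin 3) (x y z : ℕ) : (SmallVertex n → ℤ) →+ ℤ :=
  value j (x + 2) y z - value j (x + 1) (y + 1) z - value j (x + 1) y (z + 1)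
    + value j x (y + 1) (z + 1)

theorem rhombus_apply (j : Fin 3) (x y z : ℕ) (f : SmallVertex n → ℤ) :
    rhombus j x y z f = value j (x + 2) y z f - value j (x + 1) (y + 1) z f
      - value j (x + 1) y (z + 1) f + value j x (y + 1) (z + 1) f := rfl

/-- Where the flow vanishes at the interior vertices, the alternating sum over a rhombus does not
change when the rhombus slides along a line on which the coordinate `j` is constant: the difference
of two neighbouring sums is the sum over a hexagon. -/
theorem rhombus_slide {f : SmallVertex n → ℤ}
    (hf : ∀ u : SmallVertex n, (∀ l, u.1 l ≠ 0) → twiceFlow f u = 0) (j : Fin 3) {x : ℕ} :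
    ∀ {y z : ℕ}, x + y + z + 2 = n → rhombus j x y z f = rhombus j x 0 (y + z) f := by
  intro y
  induction y with
  | zero => intro z _; rw [zero_add]
  | succ y ih =>
    intro z h
    have hv : (x + 1) + (y + 1) + (z + 1) = n ∧ x + 1 ≠ n ∧ y + 1 ≠ n ∧ z + 1 ≠ n := by omega
    have h1 := hf ⟨barycentric j (x + 1) (y + 1) (z + 1), isSmallVertex_barycentric.2 hv⟩
      (by rw [forall_fin_three j]; simp)
    rw [twiceFlow_interior (j := j) (x := x) (y := y) (z := z) f (by simp) (by simp)
      (by simp)] at h1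
    have h2 := ih (z := z + 1) (by omega)
    rw [show y + 1 + z = y + (z + 1) by ring, ← h2, rhombus_apply, rhombus_apply]
    linarith

/-- The second difference of the values along edge `j`. -/
theorem rhombus_add_rhombus (f : SmallVertex n → ℤ) (j : Fin 3) (x y : ℕ) :
    rhombus j x y 0 f + rhombus (j + 1) y 0 x f =
      value j (x + 2) y 0 f - 2 * value j (x + 1) (y + 1) 0 f + value j x (y + 2) 0 f := by
  simp only [rhombus_apply, value_rotate]
  ring

theorem twiceFlow_edge_eq_rhombus (f : SmallVertex n → ℤ) {u : SmallVertex n} {j : Fin 3}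
    {x y : ℕ} (hx : u.1 j = x + 1) (hy : u.1 (j + 1) = y + 1) (hz : u.1 (j + 2) = 0) :
    twiceFlow f u = -2 * rhombus j x y 0 f +
      (value j (x + 2) y 0 f - 2 * value j (x + 1) (y + 1) 0 f + value j x (y + 2) 0 f) := by
  rw [twiceFlow_edge f hx hy hz, rhombus_apply]
  ring

theorem value_corner (j : Fin 3) (f : SmallVertex n → ℤ) : value j n 0 0 f = 0 :=
  value_of_not_valid (by omega) f

theorem value_corner_succ (j : Fin 3) (f : SmallVertex n → ℤ) : value j 0 n 0 f = 0 :=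
  value_of_not_valid (by omega) f

/-- A sequence with vanishing second differences which vanishes at both ends is zero. -/
theorem eq_zero_of_second_difference {g : ℕ → ℤ} {m : ℕ} (h0 : g 0 = 0) (hm : g m = 0)
    (h : ∀ x, x + 2 ≤ m → g (x + 2) - 2 * g (x + 1) + g x = 0) : ∀ x ≤ m, g x = 0 := by
  have lin : ∀ x, (x ≤ m → g x = x * g 1) ∧ (x + 1 ≤ m → g (x + 1) = (x + 1) * g 1) := by
    intro x
    induction x with
    | zero => simp [h0]
    | succ x ih =>
      refine ⟨fun hx => by simpa using ih.2 hx, fun hx => ?_⟩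
      have h1 := h x (by omega)
      have h2 := ih.1 (by omega)
      have h3 := ih.2 (by omega)
      push_cast
      rw [show x + 1 + 1 = x + 2 by ring]
      linear_combination h1 + 2 * h3 - h2
  intro x hx
  have h1 := (lin m).1 le_rfl
  rw [hm] at h1
  rcases mul_eq_zero.1 h1.symm with h2 | h2
  · have h3 : x = 0 := by have : m = 0 := by exact_mod_cast h2
                          omega
    rw [h3, h0]
  · rw [(lin x).1 hx, h2, mul_zero]

/-- A function on the small vertices (extended by zero to the ideal vertices) all of whose rhombus
sums vanish is affine, hence zero. -/
theorem eq_zero_of_rhombus {f : SmallVertex n → ℤ}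
    (h : ∀ (j : Fin 3) (x y z : ℕ), x + y + z + 2 = n → rhombus j x y z f = 0) : f = 0 := by
  have edge : ∀ (j : Fin 3) (x y : ℕ), x + y = n → value j x y 0 f = 0 := by
    intro j x y hxy
    have key := eq_zero_of_second_difference (g := fun x => value j x (n - x) 0 f) (m := n)
      (by simpa using value_corner_succ j f) (by simpa using value_corner j f) ?_ x (by omega)
    · simpa only [show n - x = y by omega] using key
    · intro x hx
      obtain ⟨y, rfl⟩ := Nat.exists_eq_add_of_le hx
      have h1 := rhombus_add_rhombus f j x y
      rw [h j x y 0 (by omega), h (j + 1) y 0 x (by omega)] at h1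
      simp only [show x + 2 + y - (x + 2) = y by omega,
        show x + 2 + y - (x + 1) = y + 1 by omega, show x + 2 + y - x = y + 2 by omega]
      rw [← h1, add_zero]
  have all : ∀ z x y : ℕ, x + y + z = n → value 0 x y z f = 0 := by
    intro z
    induction z with
    | zero => exact fun x y hxy => edge 0 x y hxy
    | succ z ihz =>
      intro x
      induction x with
      | zero =>
        intro y hy
        rw [← value_rotate]
        exact edge _ _ _ (by omega)
      | succ x ihx =>
        intro y hy
        have h1 := h 0 x y z (by omega)
        rw [rhombus_apply, ihz (x + 2) y (by omega), ihz (x + 1) (y + 1) (by omega),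
          ihx (y + 1) (by omega)] at h1
        linarith
  funext u
  rw [← value_coords u 0 f]
  exact all _ _ _ (u.sum_eq 0)

/-! ### Sums of functions of one coordinate -/

/-- The function `u ↦ ∑ l, H l (u l)` on the small vertices. -/
def coordSum (n : ℕ) (H : Fin 3 → ℕ → ℤ) (u : SmallVertex n) : ℤ := ∑ l, H l (u.1 l)

theorem value_coordSum {H : Fin 3 → ℕ → ℤ} (h0 : ∀ l, H l 0 = 0) (hn : ∀ l, H l n = 0)
    (j : Fin 3) {x y z : ℕ} (h : x + y + z = n) :
    value j x y z (coordSum n H) = H j x + H (j + 1) y + H (j + 2) z := by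
  by_cases hv : x + y + z = n ∧ x ≠ n ∧ y ≠ n ∧ z ≠ n
  · rw [value_of_valid hv, coordSum, sum_fin_three j]
    simp
  · rw [value_of_not_valid hv]
    rcases (by omega : (x = n ∧ y = 0 ∧ z = 0) ∨ (x = 0 ∧ y = n ∧ z = 0) ∨
      (x = 0 ∧ y = 0 ∧ z = n)) with ⟨hx, hy, hz⟩ | ⟨hx, hy, hz⟩ | ⟨hx, hy, hz⟩ <;>
    rw [hx, hy, hz] <;> simp [h0, hn]

theorem rhombus_coordSum {H : Fin 3 → ℕ → ℤ} (h0 : ∀ l, H l 0 = 0) (hn : ∀ l, H l n = 0)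
    (j : Fin 3) {x y z : ℕ} (h : x + y + z + 2 = n) :
    rhombus j x y z (coordSum n H) = H j (x + 2) - 2 * H j (x + 1) + H j x := by
  rw [rhombus_apply, value_coordSum h0 hn j (by omega), value_coordSum h0 hn j (by omega),
    value_coordSum h0 hn j (by omega), value_coordSum h0 hn j (by omega)]
  ring

theorem twiceFlow_coordSum_interior {H : Fin 3 → ℕ → ℤ} (h0 : ∀ l, H l 0 = 0)
    (hn : ∀ l, H l n = 0) (u : SmallVertex n) (hu : ∀ l, u.1 l ≠ 0) :
    twiceFlow (coordSum n H) u = 0 := by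
  have hs := u.sum_eq 0
  obtain ⟨x, hx⟩ := Nat.exists_eq_succ_of_ne_zero (hu 0)
  obtain ⟨y, hy⟩ := Nat.exists_eq_succ_of_ne_zero (hu (0 + 1))
  obtain ⟨z, hz⟩ := Nat.exists_eq_succ_of_ne_zero (hu (0 + 2))
  rw [twiceFlow_interior _ hx hy hz]
  iterate 6 rw [value_coordSum h0 hn 0 (by omega)]
  ring

theorem twiceFlow_coordSum_edge {H : Fin 3 → ℕ → ℤ} (h0 : ∀ l, H l 0 = 0)
    (hn : ∀ l, H l n = 0) {u : SmallVertex n} {j : Fin 3} {x y : ℕ}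
    (hx : u.1 j = x + 1) (hy : u.1 (j + 1) = y + 1) (hz : u.1 (j + 2) = 0) :
    twiceFlow (coordSum n H) u =
      -(H j (x + 2) - 2 * H j (x + 1) + H j x) +
        (H (j + 1) (y + 2) - 2 * H (j + 1) (y + 1) + H (j + 1) y) := by
  have hs := u.sum_eq j
  rw [twiceFlow_edge _ hx hy hz]
  iterate 4 rw [value_coordSum h0 hn j (by omega)]
  ring

/-! ### Balanced vectors and the vectors `b(τ, v_j, i)` -/

theorem dvd_value_coord_sub (m j : Fin 3) {x y z : ℕ} (h : x + y + z = n) :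
    (n : ℤ) ∣ value j x y z (coord (n := n) m) - barycentric j x y z m := by
  by_cases hv : x + y + z = n ∧ x ≠ n ∧ y ≠ n ∧ z ≠ n
  · rw [value_of_valid hv]
    simp [coord]
  · rw [value_of_not_valid hv, zero_sub, dvd_neg]
    -- At an ideal vertex every coordinate is `0` or `n`.
    have : barycentric j x y z m = 0 ∨ barycentric j x y z m = n := by
      unfold barycentric
      split_ifs <;> omega
    rcases this with h | h <;> simp [h]

theorem dvd_rhombus_of_balanced {f : SmallVertex n → ℤ} (hf : f ∈ balancedTriangle n)
    (j : Fin 3) {x y z : ℕ} (h : x + y + z + 2 = n) : (n : ℤ) ∣ rhombus j x y z f := by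
  induction hf using AddSubgroup.closure_induction with
  | mem f hf =>
    rcases hf with ⟨m, rfl⟩ | hf
    · have h1 := dvd_value_coord_sub (n := n) m j (x := x + 2) (y := y) (z := z) (by omega)
      have h2 := dvd_value_coord_sub (n := n) m j (x := x + 1) (y := y + 1) (z := z) (by omega)
      have h3 := dvd_value_coord_sub (n := n) m j (x := x + 1) (y := y) (z := z + 1) (by omega)
      have h4 := dvd_value_coord_sub (n := n) m j (x := x) (y := y + 1) (z := z + 1) (by omega)
      have h5 := dvd_add (dvd_sub (dvd_sub h1 h2) h3) h4
      have e : rhombus j x y z (coord (n := n) m) = _ - _ - _ + _ := rhombus_apply _ _ _ _ _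
      rw [e]
      refine (dvd_iff_dvd_of_dvd_sub ?_).1 h5
      rw [(?_ : _ - _ = (0 : ℤ))]
      · exact dvd_zero _
      · unfold barycentric
        split_ifs <;> push_cast <;> ring
    · have key : ∀ x y z : ℕ, (n : ℤ) ∣ value j x y z f := by
        intro x y z
        by_cases hv : x + y + z = n ∧ x ≠ n ∧ y ≠ n ∧ z ≠ n
        · rw [value_of_valid hv]; exact hf _
        · rw [value_of_not_valid hv]; exact dvd_zero _
      exact dvd_add (dvd_sub (dvd_sub (key _ _ _) (key _ _ _)) (key _ _ _)) (key _ _ _)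
  | zero => simp
  | add f g _ _ hf hg => rw [map_add]; exact dvd_add hf hg
  | neg f _ hf => rw [map_neg]; exact hf.neg_right

/-- The tent function on `{0, …, n}` which vanishes at the end points and has its kink at `i`. -/
def tent (n i x : ℕ) : ℤ := if x ≤ i then ((n : ℤ) - i) * x else (i : ℤ) * ((n : ℤ) - x)

theorem tent_zero (n i : ℕ) : tent n i 0 = 0 := by simp [tent]

theorem tent_last {i : ℕ} (h : i < n) : tent n i n = 0 := by simp [tent, h]

/-- Up to the factor `-n`, the tent function is the Green's function of the second difference. -/
theorem tent_second_difference (n i x : ℕ) :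
    tent n i (x + 2) - 2 * tent n i (x + 1) + tent n i x = if x + 1 = i then -(n : ℤ) else 0 := by
  unfold tent
  rcases lt_trichotomy (x + 1) i with h | rfl | h
  · rw [if_pos (by omega), if_pos (by omega), if_pos (by omega), if_neg (by omega)]
    push_cast
    ring
  · rw [if_neg (by omega), if_pos le_rfl, if_pos (by omega), if_pos rfl]
    push_cast
    ring
  · rw [if_neg (by omega : ¬ x + 2 ≤ i), if_neg (by omega : ¬ x + 1 ≤ i),
      if_neg (by omega : ¬ x + 1 = i)]
    split_ifs
    · obtain rfl : i = x := by omega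
      push_cast
      ring
    · push_cast
      ring

theorem bTriangle_eq_tent {i : ℕ} (hi : i < n) (j : Fin 3) (u : SmallVertex n) :
    bTriangle j i u = tent n i (u.1 j) := by
  have hs := u.valid j
  unfold bTriangle tent coord
  split_ifs with h
  · rw [Finset.sum_eq_zero, zero_add]
    intro t ht
    rw [Finset.mem_Ico] at ht
    rw [aTriangle, if_neg (by omega), mul_zero]
  · rw [Finset.sum_eq_single (n - u.1 j)]
    · rw [aTriangle, if_pos (by omega), Nat.cast_sub (by omega)]
      ring
    · intro t _ ht
      rw [aTriangle, if_neg (by omega), mul_zero]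
    · intro ht
      rw [Finset.mem_Ico] at ht
      omega

theorem bTriangle_mem_balancedTriangle (n : ℕ) (j : Fin 3) (i : ℕ) :
    (bTriangle j i : SmallVertex n → ℤ) ∈ balancedTriangle n := by
  have h : (bTriangle j i : SmallVertex n → ℤ) =
      (fun u => ∑ t ∈ Finset.Ico 1 (n - i), (n : ℤ) * ((t : ℤ) + i - n) * aTriangle j t u) +
        ((n : ℤ) - i) • coord j := by
    funext u
    simp [bTriangle]
  rw [h]
  refine (balancedTriangle n).add_mem (AddSubgroup.subset_closure (Or.inr fun u => ?_))
    ((balancedTriangle n).zsmul_mem (AddSubgroup.subset_closure (Or.inl ⟨j, rfl⟩)) _)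
  exact Finset.dvd_sum fun t _ => by rw [mul_assoc]; exact dvd_mul_right _ _

end Triangle

/-! ### Monomials in a quantum torus -/

section Monomials

variable {V : Type*} [Fintype V]

/-- The bilinear form `∑ k(v) A(v, w) t(w)` on `ℤ^V`. -/
def twiceForm (A : V → V → ℤ) (k t : V → ℤ) : ℤ := ∑ v, ∑ w, k v * A v w * t w

theorem twiceForm_add_left (A : V → V → ℤ) (k k' t : V → ℤ) :
    twiceForm A (k + k') t = twiceForm A k t + twiceForm A k' t := by
  simp [twiceForm, add_mul, Finset.sum_add_distrib]

theorem twiceForm_add_right (A : V → V → ℤ) (k t t' : V → ℤ) :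
    twiceForm A k (t + t') = twiceForm A k t + twiceForm A k t' := by
  simp [twiceForm, mul_add, Finset.sum_add_distrib]

theorem twiceForm_zero_left (A : V → V → ℤ) (t : V → ℤ) : twiceForm A 0 t = 0 := by
  simp [twiceForm]

theorem twiceForm_zero_right (A : V → V → ℤ) (k : V → ℤ) : twiceForm A k 0 = 0 := by
  simp [twiceForm]

theorem twiceForm_swap {A : V → V → ℤ} (hA : ∀ v w, A v w = -A w v) (k t : V → ℤ) :
    twiceForm A k t = -twiceForm A t k := by
  unfold twiceForm
  rw [Finset.sum_comm, ← Finset.sum_neg_distrib]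
  refine Finset.sum_congr rfl fun v _ => ?_
  rw [← Finset.sum_neg_distrib]
  refine Finset.sum_congr rfl fun w _ => ?_
  rw [hA]
  ring

theorem twiceForm_single_left [DecidableEq V] (A : V → V → ℤ) (v : V) (a : ℤ) (t : V → ℤ) :
    twiceForm A (Pi.single v a) t = a * ∑ w, A v w * t w := by
  unfold twiceForm
  rw [Finset.sum_eq_single v]
  · simp [Finset.mul_sum, mul_assoc]
  · intro b _ hb
    simp [Pi.single_eq_of_ne hb]
  · simp

theorem twiceForm_single_single [DecidableEq V] (A : V → V → ℤ) (v w : V) (a c : ℤ) :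
    twiceForm A (Pi.single v a) (Pi.single w c) = a * c * A v w := by
  rw [twiceForm_single_left, Finset.sum_eq_single w]
  · rw [Pi.single_eq_same]; ring
  · intro b _ hb
    simp [Pi.single_eq_of_ne hb]
  · simp

/-- The operator `e_r ↦ s^{A(t, r)} e_{r + t}` on the vector space with basis `ℤ^V`. -/
noncomputable def shiftOp (A : V → V → ℤ) (s : ℂˣ) (t : V → ℤ) :
    Module.End ℂ ((V → ℤ) →₀ ℂ) :=
  Finsupp.lsum ℂ fun r => ((s ^ twiceForm A t r : ℂˣ) : ℂ) • Finsupp.lsingle (r + t)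

theorem shiftOp_single (A : V → V → ℤ) (s : ℂˣ) (t r : V → ℤ) (a : ℂ) :
    shiftOp A s t (Finsupp.single r a) =
      ((s ^ twiceForm A t r : ℂˣ) : ℂ) • Finsupp.single (r + t) a := by
  simp [shiftOp]

theorem shiftOp_zero (A : V → V → ℤ) (s : ℂˣ) : shiftOp A s 0 = 1 := by
  refine Finsupp.lhom_ext fun r a => ?_
  rw [shiftOp_single, twiceForm_zero_left, zpow_zero, Units.val_one, one_smul, add_zero]
  rfl

theorem shiftOp_mul (A : V → V → ℤ) (s : ℂˣ) (k t : V → ℤ) :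
    shiftOp A s k * shiftOp A s t =
      ((s ^ twiceForm A k t : ℂˣ) : ℂ) • shiftOp A s (k + t) := by
  refine Finsupp.lhom_ext fun r a => ?_
  rw [Module.End.mul_apply, shiftOp_single, map_smul, shiftOp_single, LinearMap.smul_apply,
    shiftOp_single, smul_smul, smul_smul, ← Units.val_mul, ← Units.val_mul, ← zpow_add,
    ← zpow_add, twiceForm_add_left, twiceForm_add_right, add_assoc r t k, add_comm t k]
  congr 3
  ring

section Representation

variable [DecidableEq V] {A : V → V → ℤ} (hA : ∀ v w, A v w = -A w v) (s : ℂˣ)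

/-- The representation of the quantum torus by shift operators: `Z_v` acts by the shift along the
basis vector of `v`. -/
noncomputable def torusRep : QuantumTorus A s →ₐ[ℂ] Module.End ℂ ((V → ℤ) →₀ ℂ) :=
  RingQuot.liftAlgHom ℂ ⟨FreeAlgebra.lift ℂ
    (Sum.elim (fun v => shiftOp A s (Pi.single v 1)) fun v => shiftOp A s (Pi.single v (-1))), by
    have hd : ∀ v, A v v = 0 := fun v => by have := hA v v; omega
    intro x y h
    cases h with
    | mul_inv v =>
      simp only [map_mul, FreeAlgebra.lift_ι_apply, Sum.elim_inl, Sum.elim_inr, map_one]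
      rw [shiftOp_mul, twiceForm_single_single, hd, ← Pi.single_add]
      simp [shiftOp_zero]
    | inv_mul v =>
      simp only [map_mul, FreeAlgebra.lift_ι_apply, Sum.elim_inl, Sum.elim_inr, map_one]
      rw [shiftOp_mul, twiceForm_single_single, hd, ← Pi.single_add]
      simp [shiftOp_zero]
    | comm v w =>
      simp only [map_mul, map_smul, FreeAlgebra.lift_ι_apply, Sum.elim_inl]
      rw [shiftOp_mul, shiftOp_mul, smul_smul, twiceForm_single_single, twiceForm_single_single,
        ← Units.val_mul, add_comm (Pi.single w 1), ← zpow_natCast, ← zpow_mul, ← zpow_add, hA w v]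
      congr 3
      push_cast
      ring⟩

theorem torusRep_torusGen (v : V) :
    torusRep hA s (torusGen A s v : QuantumTorus A s) = shiftOp A s (Pi.single v 1) := by
  simp [torusRep, torusGen]

theorem torusRep_torusGen_inv (v : V) :
    torusRep hA s ((torusGen A s v)⁻¹ : (QuantumTorus A s)ˣ) = shiftOp A s (Pi.single v (-1)) := by
  simp [torusRep, torusGen]

theorem torusRep_torusGen_zpow (v : V) (m : ℤ) :
    torusRep hA s (torusGen A s v ^ m : (QuantumTorus A s)ˣ) = shiftOp A s (Pi.single v m) := by
  have hd : A v v = 0 := by have := hA v v; omega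
  induction m using Int.induction_on with
  | zero => simp [shiftOp_zero]
  | succ k ih =>
    rw [zpow_add_one, Units.val_mul, map_mul, ih, torusRep_torusGen, shiftOp_mul,
      twiceForm_single_single, hd, ← Pi.single_add]
    simp
  | pred k ih =>
    rw [zpow_sub_one, Units.val_mul, map_mul, ih, torusRep_torusGen_inv, shiftOp_mul,
      twiceForm_single_single, hd, ← Pi.single_add]
    simp [sub_eq_add_neg]

theorem twiceForm_single_list_sum (v : V) (t : V → ℤ) (l : List V) :
    twiceForm A (Pi.single v (t v)) (l.map fun w => Pi.single w (t w)).sum =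
      (l.map fun w => t v * t w * A v w).sum := by
  induction l with
  | nil => simp [twiceForm_zero_right]
  | cons w l ih =>
    rw [List.map_cons, List.sum_cons, twiceForm_add_right, ih, twiceForm_single_single,
      List.map_cons, List.sum_cons]

theorem torusRep_orderedProduct (t : V → ℤ) (l : List V) :
    torusRep hA s (orderedProduct A s t l : (QuantumTorus A s)ˣ) =
      ((s ^ weylExponent A t l : ℂˣ) : ℂ) •
        shiftOp A s (l.map fun v => Pi.single v (t v)).sum := by
  induction l with
  | nil => simp [orderedProduct, weylExponent, shiftOp_zero]
  | cons v l ih =>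
    have e : orderedProduct A s t (v :: l) =
        torusGen A s v ^ t v * orderedProduct A s t l := by simp [orderedProduct]
    rw [e, Units.val_mul, map_mul, ih, torusRep_torusGen_zpow, mul_smul_comm, shiftOp_mul,
      twiceForm_single_list_sum, smul_smul, ← Units.val_mul, ← zpow_add, List.map_cons,
      List.sum_cons, weylExponent, add_comm (weylExponent A t l)]

/-- Weyl-ordered monomials act by shifts: the Weyl exponent makes up exactly for the ordering. -/
theorem torusRep_weylMonomial (t : V → ℤ) :
    torusRep hA s (weylMonomial A s t) = shiftOp A s t := by
  rw [weylMonomial, map_smul, torusRep_orderedProduct, smul_smul, ← Units.val_mul, ← zpow_add,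
    neg_add_cancel, zpow_zero, Units.val_one, one_smul, Finset.sum_map_toList,
    Finset.univ_sum_single]

/-- The coefficients of an element of the quantum torus with respect to the Weyl-ordered monomials:
the result of letting the element act on the basis vector `e_0`. -/
noncomputable def torusCoeff : QuantumTorus A s →ₗ[ℂ] (V → ℤ) →₀ ℂ :=
  LinearMap.applyₗ (Finsupp.single 0 1) ∘ₗ (torusRep hA s).toLinearMap

theorem torusCoeff_weylMonomial (t : V → ℤ) :
    torusCoeff hA s (weylMonomial A s t) = Finsupp.single t 1 := by
  change torusRep hA s (weylMonomial A s t) (Finsupp.single 0 1) = _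
  rw [torusRep_weylMonomial, shiftOp_single, twiceForm_zero_right]
  simp

theorem torusCoeff_linearCombination (c : (V → ℤ) →₀ ℂ) :
    torusCoeff hA s (Finsupp.linearCombination ℂ (weylMonomial A s) c) = c := by
  induction c using Finsupp.induction_linear with
  | zero => simp
  | add c d hc hd => rw [map_add, map_add, hc, hd]
  | single t a =>
    rw [Finsupp.linearCombination_single, map_smul, torusCoeff_weylMonomial]
    simp

end Representation

/-- The scalar in the product of two Weyl-ordered monomials, read off in the representation. -/
theorem weylMonomial_mul_weylMonomial {A : V → V → ℤ} (hA : ∀ v w, A v w = -A w v) (s : ℂˣ)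
    (k t : V → ℤ) : weylMonomial A s k * weylMonomial A s t =
      ((s ^ twiceForm A k t : ℂˣ) : ℂ) • weylMonomial A s (k + t) := by
  classical
  obtain ⟨c, hc⟩ := weylMonomial_mul A s k t
  have h := congrArg (fun x => torusRep hA s x (Finsupp.single 0 1)) hc
  simp only [map_mul, map_smul, torusRep_weylMonomial, shiftOp_mul, LinearMap.smul_apply,
    shiftOp_single, twiceForm_zero_right, zpow_zero, Units.val_one, one_smul] at h
  have h' := congrArg (fun g : (V → ℤ) →₀ ℂ => g (0 + (k + t))) h
  simp only [Finsupp.smul_apply, Finsupp.single_eq_same, smul_eq_mul, mul_one] at h'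
  rw [hc, h']

theorem torusCoeff_mul_weylMonomial [DecidableEq V] {A : V → V → ℤ}
    (hA : ∀ v w, A v w = -A w v) (s : ℂˣ) (c : (V → ℤ) →₀ ℂ) (k t : V → ℤ) :
    torusCoeff hA s (Finsupp.linearCombination ℂ (weylMonomial A s) c * weylMonomial A s t)
      (k + t) = ((s ^ twiceForm A k t : ℂˣ) : ℂ) * c k := by
  induction c using Finsupp.induction_linear with
  | zero => simp
  | add c d hc hd => simp only [LinearMap.map_add, add_mul, Finsupp.add_apply, hc, hd, mul_add]
  | single r a =>
    rw [Finsupp.linearCombination_single, smul_mul_assoc, weylMonomial_mul_weylMonomial hA,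
      map_smul, map_smul, torusCoeff_weylMonomial]
    simp only [Finsupp.smul_apply, smul_eq_mul, Finsupp.single_apply, add_left_inj]
    split_ifs with h
    · rw [h]; ring
    · ring

theorem torusCoeff_weylMonomial_mul [DecidableEq V] {A : V → V → ℤ}
    (hA : ∀ v w, A v w = -A w v) (s : ℂˣ) (c : (V → ℤ) →₀ ℂ) (k t : V → ℤ) :
    torusCoeff hA s (weylMonomial A s t * Finsupp.linearCombination ℂ (weylMonomial A s) c)
      (k + t) = ((s ^ twiceForm A t k : ℂˣ) : ℂ) * c k := by
  induction c using Finsupp.induction_linear with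
  | zero => simp
  | add c d hc hd => simp only [LinearMap.map_add, Finsupp.add_apply, hc, hd, mul_add]
  | single r a =>
    rw [Finsupp.linearCombination_single, mul_smul_comm, weylMonomial_mul_weylMonomial hA,
      map_smul, map_smul, torusCoeff_weylMonomial, add_comm t r]
    simp only [Finsupp.smul_apply, smul_eq_mul, Finsupp.single_apply, add_left_inj]
    split_ifs with h
    · rw [h]; ring
    · ring

/-! ### The center of a monomial subalgebra -/

theorem mem_monomialSubalgebra_iff {A : V → V → ℤ} {s : ℂˣ} {Λ : AddSubgroup (V → ℤ)}
    {x : QuantumTorus A s} : x ∈ monomialSubalgebra A s Λ ↔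
      ∃ c ∈ Finsupp.supported ℂ ℂ (Λ : Set (V → ℤ)),
        Finsupp.linearCombination ℂ (weylMonomial A s) c = x :=
  Finsupp.mem_span_image_iff_linearCombination ℂ

theorem weylMonomial_mem_monomialSubalgebra {A : V → V → ℤ} {s : ℂˣ} {Λ : AddSubgroup (V → ℤ)}
    {k : V → ℤ} (hk : k ∈ Λ) : weylMonomial A s k ∈ monomialSubalgebra A s Λ :=
  Submodule.subset_span ⟨k, hk, rfl⟩

/-- Monomials with exponents in the radical are central. -/
theorem weylMonomial_commute {A : V → V → ℤ} (hA : ∀ v w, A v w = -A w v) (s : ℂˣ)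
    {Λ : AddSubgroup (V → ℤ)} {k : V → ℤ} (hk : ∀ t ∈ Λ, twiceForm A k t = 0)
    {x : QuantumTorus A s} (hx : x ∈ monomialSubalgebra A s Λ) :
    x * weylMonomial A s k = weylMonomial A s k * x := by
  change x ∈ Submodule.span ℂ _ at hx
  induction hx using Submodule.span_induction with
  | mem x hx =>
    obtain ⟨t, ht, rfl⟩ := hx
    rw [weylMonomial_mul_weylMonomial hA, weylMonomial_mul_weylMonomial hA, twiceForm_swap hA t k,
      hk t ht, neg_zero, add_comm]
  | zero => simp
  | add x y _ _ hx hy => rw [add_mul, mul_add, hx, hy]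
  | smul a x _ hx => rw [smul_mul_assoc, mul_smul_comm, hx]

/-- If `s` is not a root of unity, all exponents of a central element lie in the radical: the two
products with `Z^t` differ in the coefficient of `Z^{k + t}` by the factor `s^{2 A(k, t)}`. -/
theorem twiceForm_eq_zero_of_central {A : V → V → ℤ} (hA : ∀ v w, A v w = -A w v) {s : ℂˣ}
    (hs : ∀ m : ℤ, s ^ m = 1 → m = 0) {Λ : AddSubgroup (V → ℤ)} {c : (V → ℤ) →₀ ℂ}
    (hc : ∀ y ∈ monomialSubalgebra A s Λ, y * Finsupp.linearCombination ℂ (weylMonomial A s) c =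
      Finsupp.linearCombination ℂ (weylMonomial A s) c * y)
    {k : V → ℤ} (hk : c k ≠ 0) {t : V → ℤ} (ht : t ∈ Λ) : twiceForm A k t = 0 := by
  classical
  have h1 := congrArg (fun x => torusCoeff hA s x (k + t))
    (hc _ (weylMonomial_mem_monomialSubalgebra ht))
  simp only [torusCoeff_mul_weylMonomial, torusCoeff_weylMonomial_mul] at h1
  have h2 := Units.ext (mul_right_cancel₀ hk h1)
  have h3 := hs (twiceForm A t k - twiceForm A k t) (by rw [zpow_sub, h2, mul_inv_cancel])
  have h4 := twiceForm_swap hA t k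
  omega

/-- Let the radical of the form on `Λ` be free with basis `b`. If `s` is not a root of unity, the
center of the monomial subalgebra of `Λ` is the Laurent polynomial algebra in the `Z^{b i}`. -/
theorem exists_algEquiv_center {A : V → V → ℤ} (hA : ∀ v w, A v w = -A w v) {s : ℂˣ}
    (hs : ∀ m : ℤ, s ^ m = 1 → m = 0) (Λ : AddSubgroup (V → ℤ)) {ι : Type*} (b : ι → V → ℤ)
    (hb : LinearIndependent ℤ b)
    (hR : (AddSubgroup.closure (Set.range b) : Set (V → ℤ)) =
      {k | k ∈ Λ ∧ ∀ t ∈ Λ, twiceForm A k t = 0}) :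
    ∃ φ : AddMonoidAlgebra ℂ (ι →₀ ℤ) ≃ₐ[ℂ] Subalgebra.center ℂ (monomialSubalgebra A s Λ),
      ∀ i, ((φ (AddMonoidAlgebra.single (Finsupp.single i 1) 1) : monomialSubalgebra A s Λ) :
        QuantumTorus A s) = weylMonomial A s (b i) := by
  classical
  set B := Finsupp.linearCombination ℤ b with hB
  have hBR : ∀ k, k ∈ Set.range B ↔ k ∈ Λ ∧ ∀ t ∈ Λ, twiceForm A k t = 0 := by
    intro k
    have h1 : k ∈ (AddSubgroup.closure (Set.range b) : Set (V → ℤ)) ↔ _ := Set.ext_iff.1 hR k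
    rw [Set.mem_ofPred_eq] at h1
    rw [← h1, SetLike.mem_coe, ← Submodule.span_int_eq_addSubgroupClosure,
      Submodule.mem_toAddSubgroup, ← Finsupp.range_linearCombination]
    rfl
  have hBΛ : ∀ c, B c ∈ Λ := fun c => ((hBR _).1 ⟨c, rfl⟩).1
  have hB0 : ∀ c, ∀ t ∈ Λ, twiceForm A (B c) t = 0 := fun c => ((hBR _).1 ⟨c, rfl⟩).2
  let F : Multiplicative (ι →₀ ℤ) →* QuantumTorus A s :=
    { toFun := fun c => weylMonomial A s (B c.toAdd)
      map_one' := by rw [toAdd_one, map_zero, weylMonomial_zero]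
      map_mul' := fun c d => by
        rw [weylMonomial_mul_weylMonomial hA, hB0 _ _ (hBΛ _), zpow_zero, Units.val_one, one_smul,
          toAdd_mul, map_add] }
  let ψ := AddMonoidAlgebra.lift ℂ (QuantumTorus A s) (ι →₀ ℤ) F
  have hψ : ∀ x, ψ x =
      Finsupp.linearCombination ℂ (weylMonomial A s) (Finsupp.mapDomain B x.coeff) := by
    intro x
    rw [Finsupp.linearCombination_mapDomain]
    exact AddMonoidAlgebra.lift_apply F x
  have hψmem : ∀ x, ψ x ∈ monomialSubalgebra A s Λ := by
    intro x
    rw [hψ, Finsupp.linearCombination_mapDomain]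
    exact Subalgebra.sum_mem _ fun c _ => Subalgebra.smul_mem _
      (weylMonomial_mem_monomialSubalgebra (hBΛ c)) _
  let ψ₁ := ψ.codRestrict (monomialSubalgebra A s Λ) hψmem
  have hψ₁ : ∀ x, ψ₁ x ∈ Subalgebra.center ℂ (monomialSubalgebra A s Λ) := by
    intro x
    rw [Subalgebra.mem_center_iff]
    rintro ⟨y, hy⟩
    refine Subtype.ext ?_
    change y * ψ x = ψ x * y
    rw [hψ, Finsupp.linearCombination_mapDomain, Finsupp.linearCombination_apply, Finsupp.sum,
      Finset.mul_sum, Finset.sum_mul]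
    refine Finset.sum_congr rfl fun c _ => ?_
    rw [mul_smul_comm, smul_mul_assoc, Function.comp_apply, weylMonomial_commute hA s (hB0 c) hy]
  let ψ₂ := ψ₁.codRestrict (Subalgebra.center ℂ (monomialSubalgebra A s Λ)) hψ₁
  have hinj : Function.Injective ψ₂ := by
    intro x y hxy
    have h1 : ψ x = ψ y := congrArg (fun z : Subalgebra.center ℂ (monomialSubalgebra A s Λ) =>
      ((z : monomialSubalgebra A s Λ) : QuantumTorus A s)) hxy
    rw [hψ, hψ] at h1
    have h2 := congrArg (torusCoeff hA s) h1
    rw [torusCoeff_linearCombination, torusCoeff_linearCombination] at h2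
    exact AddMonoidAlgebra.coeff_injective (Finsupp.mapDomain_injective hb h2)
  have hsurj : Function.Surjective ψ₂ := by
    rintro ⟨⟨x, hx⟩, hcen⟩
    obtain ⟨c, hcΛ, rfl⟩ := mem_monomialSubalgebra_iff.1 hx
    rw [Subalgebra.mem_center_iff] at hcen
    have hrange : (c.support : Set (V → ℤ)) ⊆ Set.range B := by
      intro k hk
      rw [hBR]
      refine ⟨hcΛ hk, fun t ht => twiceForm_eq_zero_of_central hA hs ?_
        (Finsupp.mem_support_iff.1 hk) ht⟩
      intro y hy
      exact congrArg Subtype.val (hcen ⟨y, hy⟩)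
    refine ⟨AddMonoidAlgebra.ofCoeff (c.comapDomain B hb.injOn), ?_⟩
    refine Subtype.ext (Subtype.ext ?_)
    change ψ _ = _
    rw [hψ]
    change Finsupp.linearCombination ℂ (weylMonomial A s)
      (Finsupp.mapDomain B (c.comapDomain B hb.injOn)) = _
    rw [Finsupp.mapDomain_comapDomain B hb c hrange]
  refine ⟨AlgEquiv.ofBijective ψ₂ ⟨hinj, hsurj⟩, fun i => ?_⟩
  change ψ _ = _
  rw [AddMonoidAlgebra.lift_single, one_smul]
  change weylMonomial A s (B (Finsupp.single i 1)) = _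
  rw [hB, Finsupp.linearCombination_single, one_smul]

end Monomials

namespace IdealTriangulation

variable {F : Type*} (T : IdealTriangulation F) {n : ℕ}

/-! ### The fibres of the gluing -/

variable {T} in
theorem GlueVertex.symm {x y : F × SmallVertex n} (h : T.GlueVertex n x y) :
    T.GlueVertex n y x := by
  obtain ⟨j, j', hg, h0, h0', h1, h2⟩ := h
  exact ⟨j', j, by rw [← hg, T.glue_glue], h0', h0, h2.symm, h1.symm⟩

/-- A small vertex lies on at most one edge of its face. -/
theorem smallVertex_edge_unique (u : SmallVertex n) {j j' : Fin 3} (h : u.1 (j + 2) = 0)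
    (h' : u.1 (j' + 2) = 0) : j = j' := by
  have h1 := u.valid j
  by_contra hne
  have h2 : j' + 2 = j ∨ j' + 2 = j + 1 := by
    revert hne
    clear h h' h1
    revert j j'
    decide
  rcases h2 with h2 | h2 <;> rw [h2] at h' <;> omega

variable {T} in
/-- Every small vertex is identified with at most one other. -/
theorem GlueVertex.unique {x y z : F × SmallVertex n} (hy : T.GlueVertex n x y)
    (hz : T.GlueVertex n x z) : y = z := by
  obtain ⟨j, j', hg, h0, h0', h1, h2⟩ := hy
  obtain ⟨i, i', hg', h3, h3', h4, h5⟩ := hz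
  obtain rfl := smallVertex_edge_unique x.2 h0 h3
  rw [hg, Prod.mk.injEq] at hg'
  obtain ⟨hτ, rfl⟩ := hg'
  exact Prod.ext hτ (SmallVertex.ext_coords j' (by omega) (by omega) (by omega))

theorem vertex_eq_iff {τ τ' : F} {u u' : SmallVertex n} :
    T.vertex τ u = T.vertex τ' u' ↔
      (τ, u) = (τ', u') ∨ T.GlueVertex n (τ, u) (τ', u') := by
  constructor
  · have key : ∀ x y : F × SmallVertex n, Relation.EqvGen (T.GlueVertex n) x y →
        x = y ∨ T.GlueVertex n x y := by
      intro x y h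
      induction h with
      | rel x y h => exact Or.inr h
      | refl x => exact Or.inl rfl
      | symm x y _ ih => exact ih.imp Eq.symm GlueVertex.symm
      | trans x y z _ _ ih1 ih2 =>
        rcases ih1 with rfl | h
        · exact ih2
        · rcases ih2 with rfl | h'
          · exact Or.inr h
          · exact Or.inl (h.symm.unique h')
    exact fun h => key _ _ (Quot.eqvGen_exact h)
  · rintro (h | h)
    · exact congrArg (Quot.mk _) h
    · exact Quot.sound h

/-- The small vertex on edge `j` with coordinates `x + 1` and `y + 1`. -/
def edgeVertex (j : Fin 3) {x y : ℕ} (h : x + y + 2 = n) : SmallVertex n :=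
  ⟨barycentric j (x + 1) (y + 1) 0, isSmallVertex_barycentric.2 (by omega)⟩

theorem glueVertex_edgeVertex {τ τ' : F} {j j' : Fin 3} (hg : T.glue (τ, j) = (τ', j')) {x y : ℕ}
    (h : x + y + 2 = n) (h' : y + x + 2 = n) :
    T.GlueVertex n (τ, edgeVertex j h) (τ', edgeVertex j' h') :=
  ⟨j, j', hg, by simp [edgeVertex], by simp [edgeVertex], by simp [edgeVertex],
    by simp [edgeVertex]⟩

theorem value_pullback_glue (k : T.Vertex n → ℤ) {τ τ' : F} {j j' : Fin 3}
    (hg : T.glue (τ, j) = (τ', j')) {x y : ℕ} :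
    value j x y 0 (T.pullback n τ k) = value j' y x 0 (T.pullback n τ' k) := by
  by_cases hv : x + y + 0 = n ∧ x ≠ n ∧ y ≠ n ∧ 0 ≠ n
  · rw [value_of_valid hv, value_of_valid (by omega)]
    refine congrArg k (Quot.sound ⟨j, j', hg, ?_, ?_, ?_, ?_⟩) <;> simp
  · rw [value_of_not_valid hv, value_of_not_valid (by omega)]

theorem mem_balanced_of_dvd {k : T.Vertex n → ℤ} (h : ∀ v, (n : ℤ) ∣ k v) : k ∈ T.balanced n :=
  AddSubgroup.mem_iInf.2 fun _ => AddSubgroup.subset_closure (Or.inr fun _ => h _)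

/-! ### The vectors `b(λ, p, i)` -/

open Classical in
theorem pullback_b (τ : F) (p : T.Puncture) (i : Level n) : T.pullback n τ (T.b n p i) =
    coordSum n fun l x => if T.puncture τ l = p then tent n i x else 0 := by
  funext u
  change (∑ l, if T.puncture τ l = p then bTriangle l i.1 u else 0) = _
  refine Finset.sum_congr rfl fun l _ => ?_
  rw [bTriangle_eq_tent i.2.2]

open Classical in
theorem rhombus_pullback_b (τ : F) (p : T.Puncture) (i : Level n) (j : Fin 3) {x y z : ℕ}
    (h : x + y + z + 2 = n) : rhombus j x y z (T.pullback n τ (T.b n p i)) =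
      if T.puncture τ j = p ∧ x + 1 = i then -(n : ℤ) else 0 := by
  rw [pullback_b, rhombus_coordSum _ _ j h]
  · by_cases hp : T.puncture τ j = p
    · simp only [hp, if_true, true_and, tent_second_difference]
    · simp [hp]
  · intro l; simp [tent_zero]
  · intro l; simp [tent_last i.2.2]

theorem b_mem_balanced (p : T.Puncture) (i : Level n) : T.b n p i ∈ T.balanced n := by
  classical
  refine AddSubgroup.mem_iInf.2 fun τ => ?_
  have h : T.pullback n τ (T.b n p i) =
      ∑ j : Fin 3, if T.puncture τ j = p then bTriangle j i.1 else 0 := by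
    funext u
    rw [Finset.sum_apply]
    change (∑ l, if T.puncture τ l = p then bTriangle l i.1 u else 0) = _
    refine Finset.sum_congr rfl fun j _ => ?_
    split_ifs <;> rfl
  change T.pullback n τ (T.b n p i) ∈ balancedTriangle n
  rw [h]
  refine AddSubgroup.sum_mem _ fun j _ => ?_
  split_ifs
  · exact bTriangle_mem_balancedTriangle n j i
  · exact AddSubgroup.zero_mem _

/-! ### The kernel of `Q_λ` -/

section Kernel

variable [Fintype F]

/-- The homomorphism `k ↦ 2 k Q_λ`. -/
noncomputable def twiceMulQ (n : ℕ) : (T.Vertex n → ℤ) →+ (T.Vertex n → ℤ) where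
  toFun k w := ∑ v, k v * T.twiceQ n v w
  map_zero' := by funext w; simp
  map_add' k k' := by funext w; simp [add_mul, Finset.sum_add_distrib]

theorem twiceMulQ_apply (k : T.Vertex n → ℤ) (w : T.Vertex n) :
    T.twiceMulQ n k w = ∑ v, k v * T.twiceQ n v w := rfl

open Classical in
/-- The entry of `2 k Q_λ` at `w` is the sum of the contributions of the preimages of `w`. -/
theorem twiceMulQ_eq_sum_twiceFlow (k : T.Vertex n → ℤ) (w : T.Vertex n) :
    T.twiceMulQ n k w = ∑ x : F × SmallVertex n,
      if T.vertex x.1 x.2 = w then twiceFlow (T.pullback n x.1 k) x.2 else 0 := by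
  rw [Fintype.sum_prod_type, twiceMulQ_apply]
  unfold twiceQ
  simp only [Finset.mul_sum]
  rw [Finset.sum_comm]
  refine Finset.sum_congr rfl fun τ _ => ?_
  rw [Finset.sum_comm]
  have h1 : ∀ u u' : SmallVertex n, ∑ v, k v *
      (if T.vertex τ u = v ∧ T.vertex τ u' = w then twiceQTriangle u u' else 0) =
      if T.vertex τ u' = w then T.pullback n τ k u * twiceQTriangle u u' else 0 := by
    intro u u'
    rw [Finset.sum_eq_single_of_mem (T.vertex τ u) (Finset.mem_univ _)]
    · simp only [true_and, mul_ite, mul_zero]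
      rfl
    · intro v _ hv
      rw [if_neg fun h => hv h.1.symm, mul_zero]
  calc ∑ u, ∑ v, ∑ u', k v *
        (if T.vertex τ u = v ∧ T.vertex τ u' = w then twiceQTriangle u u' else 0)
      = ∑ u, ∑ u', if T.vertex τ u' = w then T.pullback n τ k u * twiceQTriangle u u' else 0 :=
        Finset.sum_congr rfl fun u _ => by
          rw [Finset.sum_comm]; exact Finset.sum_congr rfl fun u' _ => h1 u u'
    _ = _ := by
        rw [Finset.sum_comm]
        refine Finset.sum_congr rfl fun u' _ => ?_
        split_ifs
        · rfl
        · exact Finset.sum_const_zero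

theorem twiceMulQ_interior (k : T.Vertex n → ℤ) (τ : F) {u : SmallVertex n}
    (hu : ∀ l, u.1 l ≠ 0) :
    T.twiceMulQ n k (T.vertex τ u) = twiceFlow (T.pullback n τ k) u := by
  classical
  rw [twiceMulQ_eq_sum_twiceFlow, Finset.sum_eq_single_of_mem (τ, u) (Finset.mem_univ _),
    if_pos rfl]
  rintro ⟨τ', u'⟩ _ hne
  rw [if_neg]
  intro h
  rcases T.vertex_eq_iff.1 h.symm with h | ⟨j, j', -, h, -⟩
  · exact hne h.symm
  · exact hu _ h

theorem twiceMulQ_edge (k : T.Vertex n → ℤ) {τ τ' : F} {u u' : SmallVertex n}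
    (h : T.GlueVertex n (τ, u) (τ', u')) :
    T.twiceMulQ n k (T.vertex τ u) =
      twiceFlow (T.pullback n τ k) u + twiceFlow (T.pullback n τ' k) u' := by
  classical
  have hne : (τ, u) ≠ (τ', u') := by
    obtain ⟨j, j', hg, -⟩ := h
    intro he
    refine T.not_selfFolded (τ, j) ?_
    rw [hg]
    exact (congrArg Prod.fst he).symm
  rw [twiceMulQ_eq_sum_twiceFlow, Fintype.sum_eq_add (τ, u) (τ', u') hne, if_pos rfl, if_pos]
  · exact (T.vertex_eq_iff.2 (Or.inr h)).symm
  · rintro ⟨σ, v⟩ ⟨h1, h2⟩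
    rw [if_neg]
    intro hv
    rcases T.vertex_eq_iff.1 hv.symm with hv | hv
    · exact h1 hv.symm
    · exact h2 (hv.unique h)

variable {T} in
theorem twiceFlow_eq_zero_of_mem_ker {k : T.Vertex n → ℤ} (hk : T.twiceMulQ n k = 0) (τ : F)
    (u : SmallVertex n) (hu : ∀ l, u.1 l ≠ 0) : twiceFlow (T.pullback n τ k) u = 0 := by
  rw [← T.twiceMulQ_interior k τ hu, hk, Pi.zero_apply]

/-- The second difference at the vertex `j + 1` of `τ` agrees with that at the vertex `j'` of `τ'`,
with which it is identified: the vanishing of `k Q_λ` on the common edge says that the second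
differences at `j` and at `j'` sum to that of the edge values, and so do those at `j` and
`j + 1`. -/
theorem rhombus_eq_of_glue {k : T.Vertex n → ℤ} (hk : T.twiceMulQ n k = 0) {τ τ' : F}
    {j j' : Fin 3} (hg : T.glue (τ, j) = (τ', j')) {x y : ℕ} (h : x + y + 2 = n) :
    rhombus (j + 1) y 0 x (T.pullback n τ k) = rhombus j' y 0 x (T.pullback n τ' k) := by
  have h' : y + x + 2 = n := by omega
  have h1 := T.twiceMulQ_edge k (T.glueVertex_edgeVertex hg h h')
  rw [hk, Pi.zero_apply,
    twiceFlow_edge_eq_rhombus (j := j) (x := x) (y := y) _ (by simp [edgeVertex])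
      (by simp [edgeVertex]) (by simp [edgeVertex]),
    twiceFlow_edge_eq_rhombus (j := j') (x := y) (y := x) _ (by simp [edgeVertex])
      (by simp [edgeVertex]) (by simp [edgeVertex]),
    T.value_pullback_glue k hg, T.value_pullback_glue k hg, T.value_pullback_glue k hg] at h1
  have h2 := rhombus_add_rhombus (T.pullback n τ k) j x y
  rw [T.value_pullback_glue k hg, T.value_pullback_glue k hg, T.value_pullback_glue k hg] at h2
  have h3 := rhombus_slide (twiceFlow_eq_zero_of_mem_ker hk τ') j' (x := y) (y := x) (z := 0) h'
  rw [add_zero] at h3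
  linarith

/-- On the kernel of `Q_λ` the second differences at an ideal vertex only depend on the puncture. -/
theorem rhombus_eq_of_puncture_eq {k : T.Vertex n → ℤ} (hk : T.twiceMulQ n k = 0) {τ τ' : F}
    {j j' : Fin 3} (hp : T.puncture τ j = T.puncture τ' j') {x y : ℕ} (h : x + y + 2 = n) :
    rhombus j x 0 y (T.pullback n τ k) = rhombus j' x 0 y (T.pullback n τ' k) := by
  refine congrArg (Quot.lift (fun c : F × Fin 3 => rhombus c.2 x 0 y (T.pullback n c.1 k)) ?_) hp
  rintro ⟨σ, l⟩ ⟨σ', l'⟩ ⟨i, i', hg, ⟨h1, h2⟩ | ⟨h1, h2⟩⟩ <;> dsimp only at h1 h2 hg ⊢ <;>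
    rw [h1, h2]
  · refine (T.rhombus_eq_of_glue hk (j := i') (j' := i) ?_ (by omega)).symm
    rw [← hg, T.glue_glue]
  · exact T.rhombus_eq_of_glue hk hg (by omega)

/-- The vectors `b(λ, p, i)` lie in the kernel of `Q_λ`: on an edge, the contributions of the two
faces are opposite, since both are built from the functions of the coordinates at the two ends. -/
theorem twiceMulQ_b (p : T.Puncture) (i : Level n) : T.twiceMulQ n (T.b n p i) = 0 := by
  classical
  have h0 : ∀ (τ : F) (l : Fin 3), (if T.puncture τ l = p then tent n i 0 else 0) = 0 := by
    intro τ l; simp [tent_zero]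
  have hn : ∀ (τ : F) (l : Fin 3), (if T.puncture τ l = p then tent n i n else 0) = 0 := by
    intro τ l; simp [tent_last i.2.2]
  funext w
  obtain ⟨⟨τ, u⟩, rfl⟩ := Quot.exists_rep w
  change T.twiceMulQ n _ (T.vertex τ u) = 0
  by_cases hu : ∀ l, u.1 l ≠ 0
  · rw [T.twiceMulQ_interior _ _ hu, pullback_b]
    exact twiceFlow_coordSum_interior (h0 τ) (hn τ) u hu
  · push Not at hu
    obtain ⟨l, hl⟩ := hu
    obtain ⟨j, rfl⟩ : ∃ j : Fin 3, l = j + 2 := ⟨l + 1, by rw [add_assoc]; exact (add_zero l).symm⟩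
    have hv := u.valid j
    obtain ⟨x, hx⟩ := Nat.exists_eq_succ_of_ne_zero (by omega : u.1 j ≠ 0)
    obtain ⟨y, hy⟩ := Nat.exists_eq_succ_of_ne_zero (by omega : u.1 (j + 1) ≠ 0)
    obtain ⟨τ', j', hg⟩ : ∃ τ' j', T.glue (τ, j) = (τ', j') := ⟨_, _, rfl⟩
    have hxy : x + y + 2 = n := by omega
    obtain rfl : u = edgeVertex j hxy := SmallVertex.ext_coords j (by simpa [edgeVertex] using hx)
      (by simpa [edgeVertex] using hy) (by simpa [edgeVertex] using hl)
    have p1 : T.puncture τ j = T.puncture τ' (j' + 1) :=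
      Quot.sound ⟨j, j', hg, Or.inl ⟨rfl, rfl⟩⟩
    have p2 : T.puncture τ (j + 1) = T.puncture τ' j' :=
      Quot.sound ⟨j, j', hg, Or.inr ⟨rfl, rfl⟩⟩
    rw [T.twiceMulQ_edge _ (T.glueVertex_edgeVertex hg hxy (by omega)), pullback_b, pullback_b,
      twiceFlow_coordSum_edge (h0 τ) (hn τ) (j := j) (x := x) (y := y) (by simp [edgeVertex])
        (by simp [edgeVertex]) (by simp [edgeVertex]),
      twiceFlow_coordSum_edge (h0 τ') (hn τ') (j := j') (x := y) (y := x) (by simp [edgeVertex])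
        (by simp [edgeVertex]) (by simp [edgeVertex])]
    simp only [p1, p2]
    ring

instance : Finite T.Puncture := inferInstanceAs (Finite (Quot T.GlueCorner))

instance (n : ℕ) : Finite (Level n) :=
  Finite.of_injective (fun i : Level n => (⟨i.1, i.2.2⟩ : Fin n)) fun i i' h => by
    simpa [Subtype.ext_iff] using h

noncomputable instance : Fintype T.Puncture := Fintype.ofFinite _

noncomputable instance (n : ℕ) : Fintype (Level n) := Fintype.ofFinite _

/-- The second differences of a combination of the `b(λ, p, i)` read off its coefficients. -/
theorem rhombus_pullback_sum_b (c : T.Puncture × Level n → ℤ) (τ : F) (j : Fin 3) {x y z : ℕ}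
    (h : x + y + z + 2 = n) (hx : 1 ≤ x + 1 ∧ x + 1 < n) :
    rhombus j x y z (T.pullback n τ (∑ a, c a • T.b n a.1 a.2)) =
      -(n : ℤ) * c (T.puncture τ j, ⟨x + 1, hx⟩) := by
  classical
  simp only [map_sum, map_zsmul, T.rhombus_pullback_b τ _ _ j h]
  rw [Finset.sum_eq_single_of_mem (T.puncture τ j, ⟨x + 1, hx⟩) (Finset.mem_univ _)]
  · simp [mul_comm]
  · rintro ⟨p, i⟩ - hne
    rw [if_neg, smul_zero]
    rintro ⟨rfl, hi⟩
    exact hne (Prod.ext rfl (Subtype.ext hi.symm))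

theorem linearIndependent_b (n : ℕ) :
    LinearIndependent ℤ (fun x : T.Puncture × Level n => T.b n x.1 x.2) := by
  rw [Fintype.linearIndependent_iff]
  rintro c hc ⟨p, ⟨i, hi⟩⟩
  obtain ⟨⟨τ, j⟩, rfl⟩ := Quot.exists_rep p
  obtain ⟨x, rfl⟩ := Nat.exists_eq_add_of_le' hi.1
  have h := T.rhombus_pullback_sum_b c τ j (x := x) (y := 0) (z := n - 2 - x) (by omega) hi
  rw [hc, map_zero, map_zero] at h
  rcases mul_eq_zero.1 h.symm with h | h
  · omega
  · exact h

/-- A balanced vector in the kernel of `Q_λ` is an integral combination of the `b(λ, p, i)`: its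
second differences at the punctures are multiples of `n`, and a vector all of whose second
differences vanish is zero. -/
theorem exists_eq_sum_b {k : T.Vertex n → ℤ} (hb : k ∈ T.balanced n)
    (hk : T.twiceMulQ n k = 0) :
    ∃ c : T.Puncture × Level n → ℤ, k = ∑ a, c a • T.b n a.1 a.2 := by
  have hc : ∀ a : T.Puncture × Level n, ∃ c : ℤ, ∀ (τ : F) (j : Fin 3), T.puncture τ j = a.1 →
      rhombus j (a.2.1 - 1) 0 (n - 1 - a.2.1) (T.pullback n τ k) = -(n : ℤ) * c := by
    rintro ⟨p, ⟨i, hi⟩⟩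
    obtain ⟨⟨τ, j⟩, rfl⟩ := Quot.exists_rep p
    obtain ⟨c, hc⟩ := dvd_rhombus_of_balanced (AddSubgroup.mem_iInf.1 hb τ) j
      (x := i - 1) (y := 0) (z := n - 1 - i) (by omega)
    refine ⟨-c, fun τ' j' hp => ?_⟩
    rw [T.rhombus_eq_of_puncture_eq hk (j' := j) (τ' := τ) hp (by dsimp only; omega)]
    exact hc.trans (by ring)
  choose c hc using hc
  refine ⟨c, sub_eq_zero.1 ?_⟩
  set h := k - ∑ a, c a • T.b n a.1 a.2 with hh
  have hker : T.twiceMulQ n h = 0 := by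
    rw [hh, map_sub, hk, map_sum, Finset.sum_eq_zero, sub_zero]
    intro a _
    rw [map_zsmul, twiceMulQ_b, smul_zero]
  have hpull : ∀ τ, T.pullback n τ h = 0 := by
    intro τ
    refine eq_zero_of_rhombus fun j x y z hxyz => ?_
    rw [rhombus_slide (twiceFlow_eq_zero_of_mem_ker hker τ) j hxyz, hh, map_sub, map_sub,
      T.rhombus_pullback_sum_b c τ j (by omega) (by omega)]
    have h1 := hc (T.puncture τ j, ⟨x + 1, by omega⟩) τ j rfl
    simp only [Nat.add_sub_cancel, show n - 1 - (x + 1) = y + z by omega] at h1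
    rw [h1, sub_self]
  funext w
  obtain ⟨⟨τ, u⟩, rfl⟩ := Quot.exists_rep w
  exact congrFun (hpull τ) u

theorem closure_b_eq (n : ℕ) :
    (AddSubgroup.closure (Set.range fun x : T.Puncture × Level n => T.b n x.1 x.2) :
      Set (T.Vertex n → ℤ)) = {k | k ∈ T.balanced n ∧ T.twiceMulQ n k = 0} := by
  refine Set.Subset.antisymm ?_ ?_
  · change AddSubgroup.closure _ ≤ T.balanced n ⊓ (T.twiceMulQ n).ker
    rw [AddSubgroup.closure_le]
    rintro _ ⟨a, rfl⟩
    exact ⟨T.b_mem_balanced _ _, T.twiceMulQ_b _ _⟩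
  · rintro k ⟨hb, hk⟩
    obtain ⟨c, rfl⟩ := T.exists_eq_sum_b hb hk
    exact AddSubgroup.sum_mem _ fun a _ =>
      AddSubgroup.zsmul_mem _ (AddSubgroup.subset_closure (Set.mem_range_self a)) _

/-! ### The radical of the form -/

theorem twiceQ_swap (v w : T.Vertex n) : T.twiceQ n v w = -T.twiceQ n w v := by
  unfold twiceQ
  rw [← Finset.sum_neg_distrib]
  refine Finset.sum_congr rfl fun τ _ => ?_
  rw [Finset.sum_comm, ← Finset.sum_neg_distrib]
  refine Finset.sum_congr rfl fun u _ => ?_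
  rw [← Finset.sum_neg_distrib]
  refine Finset.sum_congr rfl fun u' _ => ?_
  by_cases h : T.vertex τ u' = v <;> by_cases h' : T.vertex τ u = w <;>
    simp [h, h', twiceQTriangle]

theorem sum_mul_Q (k : T.Vertex n → ℤ) (w : T.Vertex n) :
    ∑ v, (k v : ℚ) * T.Q n v w = (T.twiceMulQ n k w : ℚ) / 2 := by
  simp [Q, twiceMulQ_apply, Finset.sum_div, mul_div_assoc]

theorem twiceForm_twiceQ (k t : T.Vertex n → ℤ) :
    twiceForm (T.twiceQ n) k t = ∑ w, T.twiceMulQ n k w * t w := by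
  unfold twiceForm
  rw [Finset.sum_comm]
  simp [twiceMulQ_apply, Finset.sum_mul]

theorem form_eq (k t : T.Vertex n → ℤ) :
    T.form n k t = (twiceForm (T.twiceQ n) k t : ℚ) / 2 := by
  simp only [form, twiceForm, Q, Int.cast_sum, Int.cast_mul, Finset.sum_div]
  refine Finset.sum_congr rfl fun v _ => Finset.sum_congr rfl fun w _ => ?_
  ring

/-- As `B_λ` contains `n ℤ^{V_λ}`, the radical of the form on it is the kernel of `Q_λ`. -/
theorem twiceMulQ_eq_zero_iff (hn : 1 ≤ n) (k : T.Vertex n → ℤ) :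
    T.twiceMulQ n k = 0 ↔ ∀ t ∈ T.balanced n, twiceForm (T.twiceQ n) k t = 0 := by
  classical
  constructor
  · intro h t _
    simp [twiceForm_twiceQ, h]
  · intro h
    funext w
    have h1 := h (Pi.single w (n : ℤ)) (T.mem_balanced_of_dvd fun v => by
      by_cases hv : v = w
      · rw [hv, Pi.single_eq_same]
      · rw [Pi.single_eq_of_ne hv]; exact dvd_zero _)
    rw [twiceForm_twiceQ, Finset.sum_eq_single_of_mem w (Finset.mem_univ _) (fun v _ hv => by
      rw [Pi.single_eq_of_ne hv, mul_zero]), Pi.single_eq_same] at h1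
    rcases mul_eq_zero.1 h1 with h1 | h1
    · exact h1
    · omega

end Kernel

end IdealTriangulation

end FockGoncharov

/-- Let `T` be a triangulated punctured surface. The radical of the form `(k, t) ↦ k Q_λ tᵀ` on `B_λ`
is the kernel of `k ↦ k Q_λ` on `B_λ`, and it is freely generated by the vectors `b(λ, p, i)`. With
`s` the chosen square root of the parameter `s ^ 2` of the balanced Fock–Goncharov algebra, if
`(s ^ 2) ^ n ^ 2` is not a root of unity, the center of this algebra is the Laurent polynomial algebra
in the elements `Z^{b(λ, p, i)}`. -/
theorem proposition4p3 {F : Type*} [Fintype F] (T : FockGoncharov.IdealTriangulation F)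
    (n : ℕ) (hn : 1 ≤ n) (s : ℂˣ) :
    (LinearIndependent ℤ
        (fun x : T.Puncture × FockGoncharov.Level n => T.b n x.1 x.2) ∧
      (AddSubgroup.closure
          (Set.range fun x : T.Puncture × FockGoncharov.Level n => T.b n x.1 x.2) :
            Set (T.Vertex n → ℤ)) =
        {k | k ∈ T.balanced n ∧ ∀ t ∈ T.balanced n, T.form n k t = 0} ∧
      (AddSubgroup.closure
          (Set.range fun x : T.Puncture × FockGoncharov.Level n => T.b n x.1 x.2) :
            Set (T.Vertex n → ℤ)) =
        {k | k ∈ T.balanced n ∧ ∀ w, ∑ v, (k v : ℚ) * T.Q n v w = 0}) ∧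
    ((∀ m : ℕ, 0 < m → ((s ^ 2) ^ (n ^ 2)) ^ m ≠ 1) →
      ∃ φ : AddMonoidAlgebra ℂ ((T.Puncture × FockGoncharov.Level n) →₀ ℤ) ≃ₐ[ℂ]
          Subalgebra.center ℂ (T.balancedAlgebra n s),
        ∀ (p : T.Puncture) (i : FockGoncharov.Level n),
          ((φ (AddMonoidAlgebra.single (Finsupp.single (p, i) 1) 1) :
              T.balancedAlgebra n s) : FockGoncharov.QuantumTorus (T.twiceQ n) s) =
            FockGoncharov.weylMonomial (T.twiceQ n) s (T.b n p i)) := by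
  have hR := T.closure_b_eq n
  refine ⟨⟨T.linearIndependent_b n, ?_, ?_⟩, fun hs => ?_⟩
  · rw [hR]
    ext k
    simp [T.twiceMulQ_eq_zero_iff hn, T.form_eq]
  · rw [hR]
    ext k
    simp [T.sum_mul_Q, funext_iff]
  · have hs' : ∀ m : ℤ, s ^ m = 1 → m = 0 := by
      intro m hm
      by_contra hne
      refine hs m.natAbs (Int.natAbs_pos.2 hne) ?_
      have h1 : s ^ m.natAbs = 1 := by
        rcases Int.natAbs_eq m with h | h
        · rw [← zpow_natCast, ← h, hm]
        · rw [h, zpow_neg, inv_eq_one, zpow_natCast] at hm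
          exact hm
      rw [← pow_mul, ← pow_mul, ← mul_assoc, mul_comm, pow_mul, h1, one_pow]
    obtain ⟨φ, hφ⟩ := FockGoncharov.exists_algEquiv_center T.twiceQ_swap hs' (T.balanced n)
      (fun x : T.Puncture × FockGoncharov.Level n => T.b n x.1 x.2) (T.linearIndependent_b n)
      (by rw [hR]; ext k; simp [T.twiceMulQ_eq_zero_iff hn])
    exact ⟨φ, fun p i => hφ (p, i)⟩
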